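/- Let $T>0$, $k\in\mathbb N$ with $k\ge 1$, and let $a\in L^\infty(0,T)$ with $a\ge 0$ a.e. and $a\not\equiv 0$. Let $H^2(\mathbb T)$ be the Hilbert space of the $u\in H^2(0,T)$ with $u(0)=u(T)$, $u'(0)=u'(T)$ and inner product $\int_0^T(uv+u'v'+u''v'')\,dt$, and let $$\mathfrak F:\mathbb R\times H^2(\mathbb T)\to L^2(0,T),\qquad \mathfrak F(\lambda,u)=u''+\lambda u+a(t)u^3 .$$ Put $\sigma_k=(2\pi k/T)^2$, $\varphi_k(t)=\sqrt{2/T}\cos(2\pi kt/T)$, $\phi_k(t)=\sqrt{2/T}\sin(2\pi kt/T)$, let $N_k\subset H^2(\mathbb T)$ be the kernel of $u\mapsto u''+\sigma_ku$, $N_k^\perp$ its orthogonal complement in $H^2(\mathbb T)$, $L(x_1,x_2)=x_1\varphi_k+x_2\phi_k$, and $Q_k v=(v,\varphi_k)_{L^2}\varphi_k+(v,\phi_k)_{L^2}\phi_k$. Let $$a_k=\int_0^T a\varphi_k^4,\quad b_k=\int_0^T a\varphi_k^3\phi_k,\quad c_k=\int_0^T a\varphi_k^2\phi_k^2,\quad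 d_k=\int_0^T a\varphi_k\phi_k^3,\quad e_k=\int_0^T a\phi_k^4,$$ and assume $a_k=3c_k$, $b_k=d_k$, $a_k=e_k$ and $b_k\ne0$. Then $a_k\pm2b_k>0$, and the following holds. **(Reduction.)** There are open neighbourhoods $I$ of $\sigma_k$ in $\mathbb R$ and $\mathcal N$ of $0$ in $N_k$ and a $\mathcal C^\infty$ function $\psi:I\times\mathcal N\to N_k^\perp$ such that $$\psi(\sigma_k,0)=0,\qquad (\mathrm{Id}-Q_k)\mathfrak F(\lambda,x+\psi(\lambda,x))=0\quad\text{for all }(\lambda,x)\in I\times\mathcal N,\tag{1}$$ and there is a neighbourhood $\mathcal O$ of $(\sigma_k,0)$ in $\mathbb R\times H^2(\mathbb T)$ such that, if $x\in N_k$, $y\in N_k^\perp$, $(\lambda,x+y)\in\mathcal O$ and $(\mathrm{Id}-Q_k)\mathfrak F(\lambda,x+y)=0$, then $\lambda\in I$, $x\in\mathcal N$ and $y=\psi(\lambda,x)$. **(Branches.)** Let $I,\mathcal N$ and the $\mathcal C^\infty$ function $\psi$ be as in (1), let $\Omega=L^{-1}(\mathcal N)\subset\mathbb R^2$, and for $(\lambda,x)\in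 I\times\Omega$ let $\mathfrak H(\lambda,x)\in\mathbb R^2$ be the vector of the $L^2$ inner products of $Q_k\mathfrak F(\lambda,Lx+\psi(\lambda,Lx))$ with $\varphi_k$ and $\phi_k$. The reduced system is $\mathfrak H(\lambda,x)=0$. For $\lambda<\sigma_k$ and $p\in\mathbb R^2$ with $(\lambda,\sqrt{\sigma_k-\lambda}\,p)\in I\times\Omega$ set $$f(\lambda,p)=(\sigma_k-\lambda)^{-3/2}\,\mathfrak H(\lambda,\sqrt{\sigma_k-\lambda}\,p),$$ and for $p=(z,w)\in\mathbb R^2$ set $$f(\sigma_k,p)=-p+\begin{pmatrix}a_kz^3+3b_kz^2w+a_kzw^2+b_kw^3\\ b_kz^3+a_kz^2w+3b_kzw^2+a_kw^3\end{pmatrix}.$$ Let $$p_1=\frac{(1,1)}{\sqrt{2(a_k+2b_k)}},\quad p_2=-p_1,\qquad p_3=\frac{(1,-1)}{\sqrt{2(a_k-2b_k)}},\quad p_4=-p_3 .$$ For each $i\in\{1,2,3,4\}$ there exist $\varepsilon_i>0$, a neighbourhood $\mathcal U_i\subset\mathbb R^2$ of $p_i$, and a $\mathcal C^1$ function $g_i=(z_i,w_i):(\sigma_k-\varepsilon_i,\sigma_k]\to\mathcal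 U_i$ such that $g_i(\sigma_k)=p_i$ and, for all $\lambda\in(\sigma_k-\varepsilon_i,\sigma_k]$, $(\lambda,\sqrt{\sigma_k-\lambda}\,g_i(\lambda))\in I\times\Omega$ and $f(\lambda,g_i(\lambda))=0$; moreover the Jacobian determinant of $f(\sigma_k,\cdot)$ at $p_i$ is nonzero. The sets $\mathcal U_1,\dots,\mathcal U_4$ are pairwise disjoint and do not contain $0$. Finally, the reduced system has, near $(\sigma_k,0,0)$ and for $\lambda<\sigma_k$, exactly these four branches of nontrivial solutions: there is a neighbourhood $V$ of $(\sigma_k,0,0)$ in $\mathbb R\times\mathbb R^2$ such that every $(\lambda,x)\in V$ with $\lambda<\sigma_k$ lies in $I\times\Omega$ and satisfies $$\mathfrak H(\lambda,x)=0\ \text{ and }\ x\ne0\iff \exists\, i\in\{1,2,3,4\}:\ \lambda>\sigma_k-\varepsilon_i\ \text{ and }\ x=\sqrt{\sigma_k-\lambda}\,\bigl(z_i(\lambda),w_i(\lambda)\bigr).$$ -/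

import Mathlib

open MeasureTheory Set Filter Topology
open scoped ENNReal ContDiff

namespace PeriodicBif

noncomputable section

/-- Lebesgue measure on one period `(0, T]`. -/
abbrev per (T : ℝ) : Measure ℝ := volume.restrict (Ioc 0 T)

/-- The real Hilbert space `L²(𝕋) = L²(0,T)`. -/
abbrev L2 (T : ℝ) : Type := Lp ℝ 2 (per T)

/-- The space `L^∞(0,T)` of the weights. -/
abbrev LInf (T : ℝ) : Type := Lp ℝ ⊤ (per T)

/-- `u ∈ H¹(𝕋)` with derivative `u' = v ∈ L²`: `u` has the absolutely continuous representative
`t ↦ c + ∫₀ᵗ v`, and this representative takes the same value at `0` and at `T`. -/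
def HasPeriodicDeriv {T : ℝ} (u v : L2 T) : Prop :=
  (∃ c : ℝ, ∀ᵐ t ∂(per T), u t = c + ∫ s in (0 : ℝ)..t, v s) ∧ ∫ s, v s ∂(per T) = 0

theorem intervalIntegrable_coe {T : ℝ} (v : L2 T) {t : ℝ} (ht : t ∈ Ioc 0 T) :
    IntervalIntegrable v volume 0 t := by
  rw [intervalIntegrable_iff_integrableOn_Ioc_of_le ht.1.le]
  have h : IntegrableOn v (Ioc 0 T) volume := (Lp.memLp v).integrable (by norm_num)
  exact h.mono_set (Ioc_subset_Ioc_right ht.2)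

theorem integrable_coe {T : ℝ} (v : L2 T) : Integrable v (per T) :=
  (Lp.memLp v).integrable (by norm_num)

/-- Pointwise a.e. identities on `(0,T]` may be integrated from `0` to any `t` in `(0,T]`. -/
theorem interval_congr {T : ℝ} {f g : ℝ → ℝ} (h : f =ᵐ[per T] g) {t : ℝ} (ht : t ∈ Ioc 0 T) :
    ∫ s in (0 : ℝ)..t, f s = ∫ s in (0 : ℝ)..t, g s := by
  rw [intervalIntegral.integral_of_le ht.1.le, intervalIntegral.integral_of_le ht.1.le]
  exact integral_congr_ae
    (ae_mono (Measure.restrict_mono (Ioc_subset_Ioc_right ht.2) le_rfl) h)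

theorem HasPeriodicDeriv.zero {T : ℝ} : HasPeriodicDeriv (0 : L2 T) 0 := by
  have h0 : ((0 : L2 T) : ℝ → ℝ) =ᵐ[per T] fun _ => 0 := Lp.coeFn_zero ℝ 2 (per T)
  refine ⟨⟨0, ?_⟩, by rw [integral_congr_ae h0]; simp⟩
  filter_upwards [h0, ae_restrict_mem measurableSet_Ioc] with t h1 ht
  rw [interval_congr h0 ht, h1]; simp

theorem HasPeriodicDeriv.add {T : ℝ} {u v u' v' : L2 T} (h : HasPeriodicDeriv u v)
    (h' : HasPeriodicDeriv u' v') : HasPeriodicDeriv (u + u') (v + v') := by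
  obtain ⟨⟨c, hc⟩, hi⟩ := h
  obtain ⟨⟨c', hc'⟩, hi'⟩ := h'
  have hv := Lp.coeFn_add v v'
  refine ⟨⟨c + c', ?_⟩, ?_⟩
  · filter_upwards [hc, hc', Lp.coeFn_add u u', ae_restrict_mem measurableSet_Ioc]
      with t h1 h2 h3 ht
    rw [interval_congr hv ht, h3]
    simp only [Pi.add_apply]
    rw [intervalIntegral.integral_add (intervalIntegrable_coe v ht)
      (intervalIntegrable_coe v' ht), h1, h2]
    ring
  · rw [integral_congr_ae hv]
    simp only [Pi.add_apply]
    rw [integral_add (integrable_coe v) (integrable_coe v'), hi, hi', add_zero]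

theorem HasPeriodicDeriv.smul {T : ℝ} {u v : L2 T} (r : ℝ) (h : HasPeriodicDeriv u v) :
    HasPeriodicDeriv (r • u) (r • v) := by
  obtain ⟨⟨c, hc⟩, hi⟩ := h
  have hv := Lp.coeFn_smul r v
  refine ⟨⟨r * c, ?_⟩, ?_⟩
  · filter_upwards [hc, Lp.coeFn_smul r u, ae_restrict_mem measurableSet_Ioc] with t h1 h3 ht
    rw [interval_congr hv ht, h3]
    simp only [Pi.smul_apply, smul_eq_mul]
    rw [intervalIntegral.integral_const_mul, h1]
    ring
  · rw [integral_congr_ae hv]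
    simp only [Pi.smul_apply, smul_eq_mul]
    rw [integral_const_mul, hi, mul_zero]

/-- The Sobolev space `H²(𝕋)`: a function `u` is stored as the triple `(u, u', u'')` in
`L² × L² × L²`, so that the inherited inner product is
`(u,v)_{H²} = ∫ u v + ∫ u' v' + ∫ u'' v''`. -/
def H2 (T : ℝ) : Submodule ℝ (PiLp 2 (fun _ : Fin 3 => L2 T)) where
  carrier := {p | HasPeriodicDeriv (p 0) (p 1) ∧ HasPeriodicDeriv (p 1) (p 2)}
  zero_mem' := ⟨HasPeriodicDeriv.zero, HasPeriodicDeriv.zero⟩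
  add_mem' := fun h h' => ⟨h.1.add h'.1, h.2.add h'.2⟩
  smul_mem' := fun r _ h => ⟨h.1.smul r, h.2.smul r⟩

/-- The class of `u` in `L²`. -/
def fnH {T : ℝ} (u : H2 T) : L2 T := (u : PiLp 2 (fun _ : Fin 3 => L2 T)) 0

/-- The class of `u''` in `L²`. -/
def deriv2H {T : ℝ} (u : H2 T) : L2 T := (u : PiLp 2 (fun _ : Fin 3 => L2 T)) 2

/-- Functions in `H²(𝕋)` are bounded. -/
theorem memLpH_top {T : ℝ} (u : H2 T) : MemLp (fnH u) ⊤ (per T) := by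
  obtain ⟨⟨⟨c, hc⟩, -⟩, -⟩ := u.2
  set v : L2 T := (u : PiLp 2 (fun _ : Fin 3 => L2 T)) 1 with hv
  refine memLp_top_of_bound (Lp.aestronglyMeasurable _) (|c| + ∫ s, |v s| ∂(per T)) ?_
  filter_upwards [hc, ae_restrict_mem measurableSet_Ioc] with t h1 ht
  change ‖((u : PiLp 2 (fun _ : Fin 3 => L2 T)) 0 : ℝ → ℝ) t‖ ≤ _
  rw [h1]
  refine (norm_add_le _ _).trans (add_le_add le_rfl ?_)
  refine (intervalIntegral.norm_integral_le_integral_norm ht.1.le).trans ?_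
  rw [intervalIntegral.integral_of_le ht.1.le]
  have h : IntegrableOn (fun s => ‖v s‖) (Ioc 0 T) volume := (integrable_coe v).norm
  exact setIntegral_mono_set h (Eventually.of_forall fun _ => norm_nonneg _)
    (Eventually.of_forall (Ioc_subset_Ioc_right ht.2))

/-- `a u³ ∈ L²` for `a ∈ L^∞` and `u ∈ H²(𝕋)`. -/
theorem memLpH_cube {T : ℝ} (a : LInf T) (u : H2 T) :
    MemLp (fun t => a t * fnH u t ^ 3) 2 (per T) := by
  have hu := memLpH_top u
  have ha : MemLp a ⊤ (per T) := Lp.memLp a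
  have h2 : MemLp (fun t => fnH u t * fnH u t) ⊤ (per T) := hu.mul hu
  have h3 : MemLp (fun t => fnH u t * fnH u t * fnH u t) ⊤ (per T) := hu.mul h2
  have h4 : MemLp (fun t => a t * (fnH u t * fnH u t * fnH u t)) ⊤ (per T) := h3.mul ha
  have h5 : (fun t => a t * fnH u t ^ 3) = fun t => a t * (fnH u t * fnH u t * fnH u t) := by
    funext t; ring
  rw [h5]
  exact h4.mono_exponent le_top

/-- The nonlinear operator `𝔉(lam, u) = u'' + lam u + a u³`, from `ℝ × H²(𝕋)` to `L²(𝕋)`. -/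
def opF {T : ℝ} (a : LInf T) (lam : ℝ) (u : H2 T) : L2 T :=
  (deriv2H u) + lam • (fnH u) + (memLpH_cube a u).toLp (fun t => a t * fnH u t ^ 3)

/-- The linearization `𝔏(lam) v = v'' + lam v` at `u = 0`. -/
def opL (T lam : ℝ) : H2 T →ₗ[ℝ] L2 T where
  toFun v := (deriv2H v) + lam • (fnH v)
  map_add' u v := by
    change ((deriv2H u) + (deriv2H v)) + lam • ((fnH u) + (fnH v)) = _
    rw [smul_add]; abel
  map_smul' r v := by
    change r • (deriv2H v) + lam • (r • (fnH v)) = r • ((deriv2H v) + lam • (fnH v))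
    rw [smul_add, smul_comm]

/-- The eigenvalue `σ_k = (2πk/T)²`. -/
def sigma (T : ℝ) (k : ℕ) : ℝ := (2 * Real.pi * k / T) ^ 2

/-- The kernel `N[𝔏(σ_k)]`. -/
def kerN (T : ℝ) (k : ℕ) : Submodule ℝ (H2 T) := LinearMap.ker (opL T (sigma T k))

/-- `φ_k(t) = √(2/T) cos(2πkt/T)`. -/
def phiC (T : ℝ) (k : ℕ) (t : ℝ) : ℝ := √(2 / T) * Real.cos (2 * Real.pi * k / T * t)

/-- `ϕ_k(t) = √(2/T) sin(2πkt/T)`. -/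
def phiS (T : ℝ) (k : ℕ) (t : ℝ) : ℝ := √(2 / T) * Real.sin (2 * Real.pi * k / T * t)

theorem memLp_of_continuous (T : ℝ) {f : ℝ → ℝ} (hf : Continuous f) : MemLp f 2 (per T) := by
  obtain ⟨C, hC⟩ := (isCompact_Icc (a := (0 : ℝ)) (b := T)).exists_bound_of_continuousOn
    hf.continuousOn
  refine MemLp.of_bound hf.aestronglyMeasurable C ?_
  filter_upwards [ae_restrict_mem measurableSet_Ioc] with t ht
  exact hC t (Ioc_subset_Icc_self ht)

theorem continuous_phiC (T : ℝ) (k : ℕ) : Continuous (phiC T k) := by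
  unfold phiC; fun_prop

theorem continuous_phiS (T : ℝ) (k : ℕ) : Continuous (phiS T k) := by
  unfold phiS; fun_prop

/-- The class of `φ_k` in `L²`. -/
def phiCL2 (T : ℝ) (k : ℕ) : L2 T := (memLp_of_continuous T (continuous_phiC T k)).toLp _

/-- The class of `ϕ_k` in `L²`. -/
def phiSL2 (T : ℝ) (k : ℕ) : L2 T := (memLp_of_continuous T (continuous_phiS T k)).toLp _

/-- A continuously differentiable function with `f 0 = f T` has a periodic derivative. -/
theorem hasPeriodicDeriv_toLp {T : ℝ} {u v : L2 T} {f g : ℝ → ℝ} (hu : u =ᵐ[per T] f)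
    (hv : v =ᵐ[per T] g) (hd : ∀ t, HasDerivAt f (g t) t) (hg : Continuous g)
    (hT : 0 < T → f T = f 0) : HasPeriodicDeriv u v := by
  have key : ∀ t, ∫ s in (0 : ℝ)..t, g s = f t - f 0 := fun t =>
    intervalIntegral.integral_eq_sub_of_hasDerivAt (fun s _ => hd s) (hg.intervalIntegrable _ _)
  refine ⟨⟨f 0, ?_⟩, ?_⟩
  · filter_upwards [hu, ae_restrict_mem measurableSet_Ioc] with t h1 ht
    rw [interval_congr hv ht, key, h1]; ring
  · rw [integral_congr_ae hv]
    rcases le_or_gt T 0 with h | h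
    · simp [per, Ioc_eq_empty_of_le h]
    · rw [← intervalIntegral.integral_of_le h.le, key, hT h, sub_self]

theorem hasDerivAt_phiC (T : ℝ) (k : ℕ) (t : ℝ) :
    HasDerivAt (phiC T k) (-(2 * Real.pi * k / T) * phiS T k t) t := by
  have h := (((hasDerivAt_id t).const_mul (2 * Real.pi * k / T)).cos).const_mul (√(2 / T))
  refine h.congr_deriv ?_
  simp only [phiS, id]; ring

theorem hasDerivAt_phiS (T : ℝ) (k : ℕ) (t : ℝ) :
    HasDerivAt (phiS T k) ((2 * Real.pi * k / T) * phiC T k t) t := by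
  have h := (((hasDerivAt_id t).const_mul (2 * Real.pi * k / T)).sin).const_mul (√(2 / T))
  refine h.congr_deriv ?_
  simp only [phiC, id]; ring

theorem phiC_periodic {T : ℝ} (k : ℕ) (hT : 0 < T) : phiC T k T = phiC T k 0 := by
  have h : 2 * Real.pi * k / T * T = k * (2 * Real.pi) := by field_simp
  simp only [phiC, h, mul_zero, Real.cos_zero, Real.cos_nat_mul_two_pi]

theorem phiS_periodic {T : ℝ} (k : ℕ) (hT : 0 < T) : phiS T k T = phiS T k 0 := by
  have h : 2 * Real.pi * k / T * T = k * (2 * Real.pi) := by field_simp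
  have h2 : Real.sin (k * (2 * Real.pi)) = 0 := by
    simpa using Real.sin_add_nat_mul_two_pi 0 k
  simp only [phiS, h, h2, mul_zero, Real.sin_zero]

theorem phiCL2_ae (T : ℝ) (k : ℕ) : phiCL2 T k =ᵐ[per T] phiC T k := MemLp.coeFn_toLp _

theorem phiSL2_ae (T : ℝ) (k : ℕ) : phiSL2 T k =ᵐ[per T] phiS T k := MemLp.coeFn_toLp _

theorem smul_ae {T : ℝ} (r : ℝ) {u : L2 T} {f : ℝ → ℝ} (h : u =ᵐ[per T] f) :
    (r • u : L2 T) =ᵐ[per T] fun t => r * f t := by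
  filter_upwards [h, Lp.coeFn_smul r u] with t h1 h2
  rw [h2, Pi.smul_apply, smul_eq_mul, h1]

/-- `φ_k` as an element of `H²(𝕋)`, with its first and second derivatives. -/
def phiCH2 (T : ℝ) (k : ℕ) : H2 T :=
  ⟨WithLp.toLp 2 ![phiCL2 T k, (-(2 * Real.pi * k / T)) • phiSL2 T k,
      (-sigma T k) • phiCL2 T k], by
    constructor
    · exact hasPeriodicDeriv_toLp (phiCL2_ae T k) (smul_ae _ (phiSL2_ae T k))
        (hasDerivAt_phiC T k) (continuous_const.mul (continuous_phiS T k)) (phiC_periodic k)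
    · refine hasPeriodicDeriv_toLp (smul_ae _ (phiSL2_ae T k)) (smul_ae _ (phiCL2_ae T k))
        (fun t => ?_) (continuous_const.mul (continuous_phiC T k))
        (fun hT => by rw [phiS_periodic k hT])
      refine ((hasDerivAt_phiS T k t).const_mul (-(2 * Real.pi * k / T))).congr_deriv ?_
      simp only [sigma]; ring⟩

/-- `ϕ_k` as an element of `H²(𝕋)`, with its first and second derivatives. -/
def phiSH2 (T : ℝ) (k : ℕ) : H2 T :=
  ⟨WithLp.toLp 2 ![phiSL2 T k, (2 * Real.pi * k / T) • phiCL2 T k,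
      (-sigma T k) • phiSL2 T k], by
    constructor
    · exact hasPeriodicDeriv_toLp (phiSL2_ae T k) (smul_ae _ (phiCL2_ae T k))
        (hasDerivAt_phiS T k) (continuous_const.mul (continuous_phiC T k)) (phiS_periodic k)
    · refine hasPeriodicDeriv_toLp (smul_ae _ (phiCL2_ae T k)) (smul_ae _ (phiSL2_ae T k))
        (fun t => ?_) (continuous_const.mul (continuous_phiS T k))
        (fun hT => by rw [phiC_periodic k hT])
      refine ((hasDerivAt_phiC T k t).const_mul (2 * Real.pi * k / T)).congr_deriv ?_
      simp only [sigma]; ring⟩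

theorem phiCH2_mem (T : ℝ) (k : ℕ) : phiCH2 T k ∈ kerN T k := by
  change (-sigma T k) • phiCL2 T k + sigma T k • phiCL2 T k = 0
  rw [neg_smul, neg_add_cancel]

theorem phiSH2_mem (T : ℝ) (k : ℕ) : phiSH2 T k ∈ kerN T k := by
  change (-sigma T k) • phiSL2 T k + sigma T k • phiSL2 T k = 0
  rw [neg_smul, neg_add_cancel]

/-- The isomorphism `L(x₁,x₂) = x₁ φ_k + x₂ ϕ_k` from `ℝ²` to `N[𝔏(σ_k)]`. -/
def isoL (T : ℝ) (k : ℕ) (x : ℝ × ℝ) : kerN T k :=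
  x.1 • ⟨phiCH2 T k, phiCH2_mem T k⟩ + x.2 • ⟨phiSH2 T k, phiSH2_mem T k⟩

/-- The projection `Q_k v = (v, φ_k) φ_k + (v, ϕ_k) ϕ_k` of `L²(𝕋)`. -/
def projQ (T : ℝ) (k : ℕ) (v : L2 T) : L2 T :=
  (inner ℝ v (phiCL2 T k)) • phiCL2 T k + (inner ℝ v (phiSL2 T k)) • phiSL2 T k

/-- The auxiliary function `𝒢_k(lam, x, y) = (I - Q_k) 𝔉(lam, x + y)`, for `x` in the kernel
`N[𝔏(σ_k)]` and `y` in its orthogonal complement in `H²(𝕋)`. -/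
def auxG {T : ℝ} (a : LInf T) (k : ℕ) (lam : ℝ) (x : kerN T k) (y : (kerN T k)ᗮ) : L2 T :=
  opF a lam ((x : H2 T) + (y : H2 T)) - projQ T k (opF a lam ((x : H2 T) + (y : H2 T)))

/-- `ψ : I × 𝒩 → N[𝔏(σ_k)]^⊥` is a smooth solution of the auxiliary equation
`(I - Q_k) 𝔉(lam, x + ψ(lam, x)) = 0`, with `ψ(σ_k, 0) = 0`, on the product of an open
neighbourhood `I` of `σ_k` and an open neighbourhood `𝒩` of `0` in the kernel. -/
structure IsReduction {T : ℝ} (a : LInf T) (k : ℕ) (I : Set ℝ) (N : Set (kerN T k))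
    (ψ : ℝ × kerN T k → (kerN T k)ᗮ) : Prop where
  isOpen_I : IsOpen I
  sigma_mem : sigma T k ∈ I
  isOpen_N : IsOpen N
  zero_mem : 0 ∈ N
  contDiffOn : ContDiffOn ℝ ∞ ψ (I ×ˢ N)
  base : ψ (sigma T k, 0) = 0
  solves : ∀ lam ∈ I, ∀ x ∈ N, auxG a k lam x (ψ (lam, x)) = 0

/-- The reduced (bifurcation) map
`ℌ(lam, x) = ((Q_k 𝔉(lam, Lx + ψ(lam, Lx)), φ_k), (Q_k 𝔉(lam, Lx + ψ(lam, Lx)), ϕ_k))`. -/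
def redH {T : ℝ} (a : LInf T) (k : ℕ) (ψ : ℝ × kerN T k → (kerN T k)ᗮ)
    (lam : ℝ) (x : ℝ × ℝ) : ℝ × ℝ :=
  let w : L2 T :=
    projQ T k (opF a lam ((isoL T k x : H2 T) + (ψ (lam, isoL T k x) : H2 T)))
  (inner ℝ w (phiCL2 T k), inner ℝ w (phiSL2 T k))

/-- `a_k = (a φ³, φ)`. -/
def coefA {T : ℝ} (a : LInf T) (k : ℕ) : ℝ := ∫ t, a t * phiC T k t ^ 3 * phiC T k t ∂(per T)

/-- `b_k = (a φ² ϕ, φ)`. -/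
def coefB {T : ℝ} (a : LInf T) (k : ℕ) : ℝ :=
  ∫ t, a t * phiC T k t ^ 2 * phiS T k t * phiC T k t ∂(per T)

/-- `c_k = (a φ ϕ², φ)`. -/
def coefC {T : ℝ} (a : LInf T) (k : ℕ) : ℝ :=
  ∫ t, a t * phiC T k t * phiS T k t ^ 2 * phiC T k t ∂(per T)

/-- `d_k = (a ϕ³, φ)`. -/
def coefD {T : ℝ} (a : LInf T) (k : ℕ) : ℝ := ∫ t, a t * phiS T k t ^ 3 * phiC T k t ∂(per T)

/-- `e_k = (a ϕ³, ϕ)`. -/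
def coefE {T : ℝ} (a : LInf T) (k : ℕ) : ℝ := ∫ t, a t * phiS T k t ^ 3 * phiS T k t ∂(per T)

/-- The homogeneous cubic with coefficients `A = a_k` and `B = b_k`. -/
def cubic (A B : ℝ) (p : ℝ × ℝ) : ℝ × ℝ :=
  (A * p.1 ^ 3 + 3 * B * p.1 ^ 2 * p.2 + A * p.1 * p.2 ^ 2 + B * p.2 ^ 3,
   B * p.1 ^ 3 + A * p.1 ^ 2 * p.2 + 3 * B * p.1 * p.2 ^ 2 + A * p.2 ^ 3)

/-- The rescaled map `f`: for `lam < σ_k` it is `(σ_k - lam)^{-3/2} ℌ(lam, √(σ_k - lam) p)`, and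
at `lam = σ_k` it is the limit `-p + 𝒞_k(p)`. -/
def rescF {T : ℝ} (a : LInf T) (k : ℕ) (ψ : ℝ × kerN T k → (kerN T k)ᗮ)
    (lam : ℝ) (p : ℝ × ℝ) : ℝ × ℝ :=
  if lam < sigma T k then
    ((√(sigma T k - lam)) ^ 3)⁻¹ • redH a k ψ lam (√(sigma T k - lam) • p)
  else -p + cubic (coefA a k) (coefB a k) p

/-- The four starting points `(z̄_i, w̄_i)` with `A = a_k` and `B = b_k`. -/
def startPt (A B : ℝ) : Fin 4 → ℝ × ℝ :=
  ![(1 / √(2 * (A + 2 * B)), 1 / √(2 * (A + 2 * B))),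
    (-1 / √(2 * (A + 2 * B)), -1 / √(2 * (A + 2 * B))),
    (1 / √(2 * (A - 2 * B)), -1 / √(2 * (A - 2 * B))),
    (-1 / √(2 * (A - 2 * B)), 1 / √(2 * (A - 2 * B)))]

end

end PeriodicBif

/-! Put `μ = σ_k - λ` and split `u = x + y`, with `x` in the kernel and `y` in its `H²`-orthogonal
complement. The linearization is symmetric in `L²`, and the `H²` complement of the kernel is also
`L²`-orthogonal to it. The problem therefore becomes a range equation `A y - μ ι y + π K(x + y) =
0`, where `A` is the linearization as an isomorphism and `K u = a u³`, together with a planar kernel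
equation `-μ p + q K(ℓ p + j y) = 0`. Since `K` has zero derivative at the origin, the implicit
function theorem solves the range equation for `y` (`exists_solution_rangeEq`), and small solutions
satisfy `‖y‖ ≤ D ‖x‖³` (`exists_norm_le_pow_three`).

Existence of the branches: the substitution `x = s p`, `y = s³ η`, `s² = μ` leaves a system in which
only `μ` occurs, so it is smooth through `μ = 0` (`rangeEq_scaling`, `kernelEq_scaling`). At `μ = 0`
it decouples into `-p + cubic p = 0` and `A η = -π K(ℓ p)`. In the variables `z ± w` the planar
cubic system factors. Because `b_k ≠ 0`, its nonzero solutions are exactly the four starting points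
(`eq_startPt_of_cubic_eq`), and they are nondegenerate (`cubicDeriv_startPt_injective`). The
implicit function theorem then yields branches that are `C¹` up to and including `μ = 0`
(`exists_scaled_branch`).

Exhaustion: `4 (a_k ± 2 b_k) = ∫ a (φ_k ± ϕ_k)⁴ > 0` makes the cubic coercive (`coefA_add_pos`,
`cubic_coercive`). Pairing the kernel equation with `x` gives `‖x‖² ≤ r μ`, so `p = x / √μ` stays in
a fixed compact ball. For small `μ` it is close to a zero of the limit field: near a starting point
local uniqueness places it on the branch, and near `0` it must vanish
(`eventually_scaled_mem_branch`).

The analytic inputs are the completeness of `H²`, solvability of the linear equation by variation of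
constants (`exists_opLL_eq`), and the embedding of `H²` in `L^∞` (`exists_supEmbedding`). -/

/-! ### Cubic maps between normed spaces -/

section Abstract

variable {E F H R X : Type*} [NormedAddCommGroup E] [NormedSpace ℝ E]
  [NormedAddCommGroup F] [NormedSpace ℝ F] [NormedAddCommGroup H] [NormedSpace ℝ H]
  [NormedAddCommGroup R] [NormedSpace ℝ R] [NormedAddCommGroup X] [NormedSpace ℝ X]

/-- A smooth map, homogeneous of degree three, with the Lipschitz bounds of a cubic form. -/
structure IsCubicMap (K : E → F) (C : ℝ) : Prop where
  contDiff : ContDiff ℝ ω K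
  nonneg : 0 ≤ C
  map_smul : ∀ (r : ℝ) (u : E), K (r • u) = r ^ 3 • K u
  lip : ∀ u v, ‖K u - K v‖ ≤ C * (‖u‖ + ‖v‖) ^ 2 * ‖u - v‖

/-- Telescoping the trilinear expression one factor at a time gives the Lipschitz bound. The
operator `u ↦ a u³` has this shape, with `S` multiplication by the bounded representative of `u`. -/
theorem isCubicMap_of_bilinear (N : F →L[ℝ] F) (S : E →L[ℝ] F →L[ℝ] F) (f : E →L[ℝ] F) :
    IsCubicMap (fun u => N (S u (S u (f u)))) (‖N‖ * (‖S‖ ^ 2 * ‖f‖)) where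
  contDiff := by fun_prop
  nonneg := by positivity
  map_smul r u := by
    simp only [map_smul, smul_apply, smul_smul]
    congr 1; ring
  lip u v := by
    have e : N (S u (S u (f u))) - N (S v (S v (f v))) =
        N (S (u - v) (S u (f u)) + S v (S (u - v) (f u)) + S v (S v (f (u - v)))) := by
      simp only [map_sub, map_add, sub_apply]; abel
    have b : ∀ x y z, ‖S x (S y (f z))‖ ≤ ‖S‖ * ‖x‖ * (‖S‖ * ‖y‖ * (‖f‖ * ‖z‖)) := fun x y z =>
      S.le_of_opNorm₂_le_of_le le_rfl le_rfl (S.le_of_opNorm₂_le_of_le le_rfl le_rfl (f.le_opNorm z))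
    rw [e, mul_assoc, mul_assoc]
    refine N.le_opNorm_of_le ((norm_add₃_le).trans
      ((add_le_add (add_le_add (b _ _ _) (b _ _ _)) (b _ _ _)).trans ?_))
    -- This is the slack in `‖u‖² + ‖u‖‖v‖ + ‖v‖² ≤ (‖u‖ + ‖v‖)²`, up to the common factor.
    have h : 0 ≤ ‖S‖ ^ 2 * ‖f‖ * (‖u - v‖ * (‖u‖ * ‖v‖)) := by positivity
    nlinarith

namespace IsCubicMap

variable {K : E → F} {C : ℝ}

theorem map_zero (h : IsCubicMap K C) : K 0 = 0 := by
  simpa using h.map_smul 0 0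

theorem norm_le (h : IsCubicMap K C) (u : E) : ‖K u‖ ≤ C * ‖u‖ ^ 3 := by
  have := h.lip u 0
  rw [h.map_zero, sub_zero, sub_zero, norm_zero, add_zero] at this
  linarith [this, show C * ‖u‖ ^ 2 * ‖u‖ = C * ‖u‖ ^ 3 by ring]

theorem hasFDerivAt_zero (h : IsCubicMap K C) : HasFDerivAt K (0 : E →L[ℝ] F) 0 := by
  refine .of_isLittleO ?_
  have h1 : (fun u : E => K u - K 0 - (0 : E →L[ℝ] F) (u - 0)) =O[𝓝 0] fun u => ‖u‖ ^ 3 := by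
    refine .of_bound C (.of_forall fun u => ?_)
    simpa [h.map_zero] using h.norm_le u
  refine h1.trans_isLittleO ?_
  have h2 := Asymptotics.isLittleO_norm_pow_id (E' := E) (n := 3) (by norm_num)
  simpa using h2

end IsCubicMap

/-- The range component of a semilinear equation whose linear part is `A - μ ι`. -/
def rangeEq (A : H ≃L[ℝ] R) (ι : H →L[ℝ] R) (π : F →L[ℝ] R) (ℓ : X →L[ℝ] E) (j : H →L[ℝ] E)
    (K : E → F) (μ : ℝ) (x : X) (y : H) : R :=
  A y - μ • ι y + π (K (ℓ x + j y))

variable {A : H ≃L[ℝ] R} {ι : H →L[ℝ] R} {π : F →L[ℝ] R} {ℓ : X →L[ℝ] E} {j : H →L[ℝ] E}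
  {K : E → F} {C : ℝ}

/-- After applying `A⁻¹`, the terms `μ ι` and `π K` are Lipschitz in `y` with a small constant near
the origin and are absorbed on the left. This gives uniqueness of small solutions, which later
identifies an arbitrary reduction `ψ` with the constructed branches. -/
theorem exists_norm_sub_le_rangeEq (hK : IsCubicMap K C) :
    ∃ δ > 0, ∃ D ≥ 0, ∀ (μ : ℝ) (x : X) (y y' : H), |μ| < δ → ‖x‖ < δ → ‖y‖ < δ → ‖y'‖ < δ →
      ‖y - y'‖ ≤ D * ‖rangeEq A ι π ℓ j K μ x y - rangeEq A ι π ℓ j K μ x y'‖ := by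
  set a := ‖(A.symm : R →L[ℝ] H)‖
  have ht : Tendsto (fun δ : ℝ => a * (δ * ‖ι‖ +
      ‖π‖ * (C * (2 * (‖ℓ‖ * δ + ‖j‖ * δ)) ^ 2 * ‖j‖))) (𝓝 0) (𝓝 0) := by
    have : Continuous (fun δ : ℝ => a * (δ * ‖ι‖ +
      ‖π‖ * (C * (2 * (‖ℓ‖ * δ + ‖j‖ * δ)) ^ 2 * ‖j‖))) := by fun_prop
    simpa using this.tendsto 0
  -- The bound `1 / 2` on the Lipschitz constant of the perturbation is what produces `D = 2 ‖A⁻¹‖`.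
  obtain ⟨δ, hδ, hlt⟩ : ∃ δ > 0, a * (δ * ‖ι‖ +
      ‖π‖ * (C * (2 * (‖ℓ‖ * δ + ‖j‖ * δ)) ^ 2 * ‖j‖)) < 1 / 2 := by
    have h1 := ht.mono_left (nhdsWithin_le_nhds (s := Ioi 0))
    have h2 := (h1.eventually (gt_mem_nhds (show (0 : ℝ) < 1 / 2 by norm_num))).and
      self_mem_nhdsWithin
    obtain ⟨δ, h3, h4⟩ := h2.exists
    exact ⟨δ, h4, h3⟩
  refine ⟨δ, hδ, 2 * a, by positivity, fun μ x y y' hμ hx hy hy' => ?_⟩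
  set r := rangeEq A ι π ℓ j K μ x y - rangeEq A ι π ℓ j K μ x y'
  have e : A (y - y') = r + μ • ι (y - y') - π (K (ℓ x + j y) - K (ℓ x + j y')) := by
    simp only [r, rangeEq, map_sub, smul_sub]; abel
  have e2 : y - y' = A.symm (r + μ • ι (y - y') - π (K (ℓ x + j y) - K (ℓ x + j y'))) := by
    rw [← e, A.symm_apply_apply]
  have n1 : ∀ z : H, ‖z‖ < δ → ‖ℓ x + j z‖ ≤ ‖ℓ‖ * δ + ‖j‖ * δ := fun z hz =>
    (norm_add_le _ _).trans (add_le_add (ℓ.le_opNorm_of_le hx.le) (j.le_opNorm_of_le hz.le))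
  have hC := hK.nonneg
  have n2 : ‖K (ℓ x + j y) - K (ℓ x + j y')‖ ≤
      C * (2 * (‖ℓ‖ * δ + ‖j‖ * δ)) ^ 2 * (‖j‖ * ‖y - y'‖) := by
    refine (hK.lip _ _).trans ?_
    have : ℓ x + j y - (ℓ x + j y') = j (y - y') := by rw [map_sub]; abel
    rw [this]
    gcongr
    · linarith [n1 y hy, n1 y' hy']
    · exact j.le_opNorm _
  have n3 : ‖y - y'‖ ≤ a * (‖r‖ + δ * (‖ι‖ * ‖y - y'‖) +
      ‖π‖ * (C * (2 * (‖ℓ‖ * δ + ‖j‖ * δ)) ^ 2 * (‖j‖ * ‖y - y'‖))) := by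
    conv_lhs => rw [e2]
    refine (A.symm : R →L[ℝ] H).le_opNorm_of_le ?_
    refine (norm_sub_le _ _).trans (add_le_add ((norm_add_le _ _).trans
      (add_le_add le_rfl ?_)) (π.le_opNorm_of_le n2))
    rw [norm_smul]
    exact mul_le_mul hμ.le (ι.le_opNorm _) (norm_nonneg _) hδ.le
  have n4 := mul_le_mul_of_nonneg_right hlt.le (norm_nonneg (y - y'))
  nlinarith

/-- Compare the solution with `y' = 0`, where the residual is `π (K (ℓ x))`, of size `O(‖x‖³)`. -/
theorem exists_norm_le_pow_three (hK : IsCubicMap K C) :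
    ∃ δ > 0, ∃ D ≥ 0, ∀ (μ : ℝ) (x : X) (y : H), |μ| < δ → ‖x‖ < δ → ‖y‖ < δ →
      rangeEq A ι π ℓ j K μ x y = 0 → ‖y‖ ≤ D * ‖x‖ ^ 3 := by
  obtain ⟨δ, hδ, D, hD, h⟩ :=
    exists_norm_sub_le_rangeEq (A := A) (ι := ι) (π := π) (ℓ := ℓ) (j := j) hK
  have hC := hK.nonneg
  refine ⟨δ, hδ, D * (‖π‖ * (C * ‖ℓ‖ ^ 3)), by positivity, fun μ x y hμ hx hy h0 => ?_⟩
  have h1 := h μ x y 0 hμ hx hy (by simpa using hδ)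
  rw [h0, sub_zero, zero_sub, norm_neg] at h1
  refine h1.trans ?_
  rw [mul_assoc]
  gcongr
  simp only [rangeEq, map_zero, smul_zero, sub_zero, zero_add, add_zero]
  rw [mul_assoc]
  refine π.le_opNorm_of_le ((hK.norm_le _).trans ?_)
  rw [mul_assoc, ← mul_pow]
  gcongr
  exact ℓ.le_opNorm x

/-- Lyapunov–Schmidt reduction: the range equation is solved near the origin by a smooth
function of the parameter and the kernel variable. -/
theorem exists_solution_rangeEq [CompleteSpace H] [CompleteSpace R] [CompleteSpace X]
    (hK : IsCubicMap K C) :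
    ∃ ψ : ℝ × X → H, ψ 0 = 0 ∧ (∀ᶠ v in 𝓝 (0 : ℝ × X), ContDiffAt ℝ ∞ ψ v) ∧
      (∀ᶠ v in 𝓝 (0 : ℝ × X), rangeEq A ι π ℓ j K v.1 v.2 (ψ v) = 0) ∧
      ∀ᶠ v in 𝓝 (0 : (ℝ × X) × H), rangeEq A ι π ℓ j K v.1.1 v.1.2 v.2 = 0 → v.2 = ψ v.1 := by
  let f : (ℝ × X) × H → R := fun v => rangeEq A ι π ℓ j K v.1.1 v.1.2 v.2
  have hf : ContDiff ℝ ω f := by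
    have := hK.contDiff
    simp only [f, rangeEq]
    fun_prop
  have f0 : f 0 = 0 := by simp [f, rangeEq, hK.map_zero]
  -- At the base point `μ ι` vanishes and `K` has zero derivative, so the partial derivative in `y`
  -- is the isomorphism `A`.
  have hd : fderiv ℝ f 0 ∘L .inr ℝ (ℝ × X) H = (A : H →L[ℝ] R) := by
    have h1 : HasFDerivAt (fun y : H => f (0, y)) (fderiv ℝ f 0 ∘L .inr ℝ (ℝ × X) H) 0 :=
      HasFDerivAt.comp (0 : H) (g := f) (f := fun y : H => ((0 : ℝ × X), y))
        ((hf.differentiable (by simp)).differentiableAt.hasFDerivAt) (hasFDerivAt_prodMk_right _ _)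
    have h2 : HasFDerivAt (fun y : H => f (0, y)) (A : H →L[ℝ] R) 0 := by
      have h3 : HasFDerivAt (fun y : H => K (j y)) ((0 : E →L[ℝ] F) ∘L j) 0 :=
        HasFDerivAt.comp (0 : H) (by simpa using hK.hasFDerivAt_zero) j.hasFDerivAt
      have h4 := (A : H →L[ℝ] R).hasFDerivAt (x := 0) |>.add (π.hasFDerivAt.comp (0 : H) h3)
      simpa [f, rangeEq, Function.comp_def] using! h4
    exact h1.unique h2
  have hi : (fderiv ℝ f 0 ∘L .inr ℝ (ℝ × X) H).IsInvertible := by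
    rw [hd]; exact ContinuousLinearMap.isInvertible_equiv
  have hfa : ContDiffAt ℝ ω f 0 := hf.contDiffAt
  refine ⟨hfa.implicitFunction (by simp) hi, hfa.implicitFunction_apply_self (by simp) hi,
    ?_, ?_, ?_⟩
  · filter_upwards [(hfa.contDiffAt_implicitFunction (by simp) hi).eventually (by simp)] with v hv
    exact hv.of_le (by simp)
  · have := hfa.eventually_apply_implicitFunction (by simp) hi
    rw [f0] at this
    exact this
  · filter_upwards [hfa.eventually_apply_eq_iff_implicitFunction (by simp) hi] with v hv h0
    rw [f0] at hv
    exact (hv.1 h0).symm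

end Abstract

namespace PeriodicBif

/-! ### The planar cubic system -/

section Planar

variable {A B : ℝ}

/-- Uniform description of the four points by a sign `e`, so that the computations below treat them
together. -/
theorem startPt_spec (hp : 0 < A + 2 * B) (hm : 0 < A - 2 * B) (i : Fin 4) :
    ∃ z e : ℝ, startPt A B i = (z, e * z) ∧ e ^ 2 = 1 ∧ 2 * (A + 2 * e * B) * z ^ 2 = 1 := by
  have h1 : √(2 * (A + 2 * B)) ^ 2 = 2 * (A + 2 * B) := Real.sq_sqrt (by linarith)
  have h2 : √(2 * (A - 2 * B)) ^ 2 = 2 * (A - 2 * B) := Real.sq_sqrt (by linarith)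
  have h3 : √(2 * (A + 2 * B)) ≠ 0 := (Real.sqrt_pos.2 (by linarith)).ne'
  have h4 : √(2 * (A - 2 * B)) ≠ 0 := (Real.sqrt_pos.2 (by linarith)).ne'
  fin_cases i
  · refine ⟨1 / √(2 * (A + 2 * B)), 1, by simp [startPt], by norm_num, ?_⟩
    rw [div_pow, h1]; field_simp [hp.ne']
  · refine ⟨-1 / √(2 * (A + 2 * B)), 1, by simp [startPt], by norm_num, ?_⟩
    rw [div_pow, h1]; field_simp [hp.ne']
  · refine ⟨1 / √(2 * (A - 2 * B)), -1, by simp [startPt, neg_div], by norm_num, ?_⟩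
    rw [div_pow, h2]; field_simp [hm.ne']; ring
  · refine ⟨-1 / √(2 * (A - 2 * B)), -1, by simp [startPt, neg_div], by norm_num, ?_⟩
    rw [div_pow, h2]; field_simp [hm.ne']; ring

theorem startPt_ne_zero (hp : 0 < A + 2 * B) (hm : 0 < A - 2 * B) (i : Fin 4) :
    startPt A B i ≠ 0 := by
  obtain ⟨z, e, h, -, hz⟩ := startPt_spec hp hm i
  rw [h]
  intro h0
  have : z = 0 := congrArg Prod.fst h0
  simp [this] at hz

theorem startPt_injective (hp : 0 < A + 2 * B) (hm : 0 < A - 2 * B) :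
    Function.Injective (startPt A B) := by
  have h3 : 0 < 1 / √(2 * (A + 2 * B)) := one_div_pos.2 (Real.sqrt_pos.2 (by linarith))
  have h4 : 0 < 1 / √(2 * (A - 2 * B)) := one_div_pos.2 (Real.sqrt_pos.2 (by linarith))
  intro i j h
  fin_cases i <;> fin_cases j <;> simp [startPt, neg_div] at h ⊢ <;> simp at h3 h4 <;> grind

theorem cubic_startPt (hp : 0 < A + 2 * B) (hm : 0 < A - 2 * B) (i : Fin 4) :
    cubic A B (startPt A B i) = startPt A B i := by
  obtain ⟨z, e, h, he, hz⟩ := startPt_spec hp hm i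
  rw [h, cubic]
  ext
  · linear_combination z * hz + (A * z ^ 3 + B * e * z ^ 3) * he
  · linear_combination e * z * hz + (3 * B * z ^ 3 + A * e * z ^ 3 - 4 * B * z ^ 3) * he

/-- The sum and the difference of the two equations factor through `z + w` and `z - w`. The
vanishing of exactly one of these gives the four points. -/
theorem eq_startPt_of_cubic_eq (hp : 0 < A + 2 * B) (hm : 0 < A - 2 * B) (hB : B ≠ 0)
    {p : ℝ × ℝ} (h : cubic A B p = p) (h0 : p ≠ 0) : ∃ i, p = startPt A B i := by
  obtain ⟨z, w⟩ := p
  simp only [cubic, Prod.mk.injEq] at h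
  obtain ⟨h1, h2⟩ := h
  have e1 : (z + w) * ((A + 2 * B) * (z + w) ^ 2 + A * (z - w) ^ 2 - 2) = 0 := by
    linear_combination 2 * h1 + 2 * h2
  have e2 : (z - w) * ((A - 2 * B) * (z - w) ^ 2 + A * (z + w) ^ 2 - 2) = 0 := by
    linear_combination 2 * h1 - 2 * h2
  have root : ∀ {x D : ℝ}, 0 < D → 2 * D * x ^ 2 = 1 → x = 1 / √(2 * D) ∨ x = -1 / √(2 * D) := by
    intro x D hD hx
    have hs : √(2 * D) ^ 2 = 2 * D := Real.sq_sqrt (by linarith)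
    have hs0 : √(2 * D) ≠ 0 := (Real.sqrt_pos.2 (by linarith)).ne'
    have : (x * √(2 * D)) * (x * √(2 * D)) = 1 := by linear_combination hx + x ^ 2 * hs
    rcases mul_self_eq_one_iff.1 this with h | h
    · left; rw [eq_div_iff hs0, h]
    · right; rw [eq_div_iff hs0, h]
  rcases mul_eq_zero.1 e1 with hs | hs <;> rcases mul_eq_zero.1 e2 with hd | hd
  · refine absurd ?_ h0
    rw [show z = 0 by linarith, show w = 0 by linarith]; rfl
  · have hw : w = -z := by linarith
    subst hw
    rcases root hm (show 2 * (A - 2 * B) * z ^ 2 = 1 by linarith) with h | h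
    · exact ⟨2, by simp [startPt, h, neg_div]⟩
    · exact ⟨3, by simp [startPt, h, neg_div]⟩
  · have hw : w = z := by linarith
    subst hw
    rcases root hp (show 2 * (A + 2 * B) * w ^ 2 = 1 by linarith) with h | h
    · exact ⟨0, by simp [startPt, h]⟩
    · exact ⟨1, by simp [startPt, h]⟩
  -- If neither `z + w` nor `z - w` vanishes, eliminating one square at a time shows that `B` and
  -- `-B` are both nonnegative.
  · exfalso
    have k1 : 4 * B ^ 2 * (z + w) ^ 2 = 4 * B := by
      linear_combination A * hd - (A - 2 * B) * hs
    have k2 : 4 * B ^ 2 * (z - w) ^ 2 = -(4 * B) := by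
      linear_combination A * hs - (A + 2 * B) * hd
    have k3 : 0 ≤ 4 * B ^ 2 * (z + w) ^ 2 := by positivity
    have k4 : 0 ≤ 4 * B ^ 2 * (z - w) ^ 2 := by positivity
    exact hB (by linarith)

/-- The derivative of `p ↦ -p + cubic A B p`. -/
noncomputable def cubicDeriv (A B : ℝ) (p : ℝ × ℝ) : ℝ × ℝ →L[ℝ] ℝ × ℝ :=
  ((3 * A * p.1 ^ 2 + 6 * B * p.1 * p.2 + A * p.2 ^ 2 - 1) • ContinuousLinearMap.fst ℝ ℝ ℝ +
    (3 * B * p.1 ^ 2 + 2 * A * p.1 * p.2 + 3 * B * p.2 ^ 2) • ContinuousLinearMap.snd ℝ ℝ ℝ).prod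
  ((3 * B * p.1 ^ 2 + 2 * A * p.1 * p.2 + 3 * B * p.2 ^ 2) • ContinuousLinearMap.fst ℝ ℝ ℝ +
    (A * p.1 ^ 2 + 6 * B * p.1 * p.2 + 3 * A * p.2 ^ 2 - 1) • ContinuousLinearMap.snd ℝ ℝ ℝ)

theorem hasFDerivAt_cubic (A B : ℝ) (p : ℝ × ℝ) :
    HasFDerivAt (fun p => -p + cubic A B p) (cubicDeriv A B p) p := by
  have hx : HasFDerivAt (fun p : ℝ × ℝ => p.1) (ContinuousLinearMap.fst ℝ ℝ ℝ) p := hasFDerivAt_fst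
  have hy : HasFDerivAt (fun p : ℝ × ℝ => p.2) (ContinuousLinearMap.snd ℝ ℝ ℝ) p := hasFDerivAt_snd
  have h1 := (((((hx.pow 3).const_mul A).add (((hx.pow 2).const_mul (3 * B)).mul hy)).add
    ((hx.const_mul A).mul (hy.pow 2))).add ((hy.pow 3).const_mul B))
  have h2 := (((((hx.pow 3).const_mul B).add (((hx.pow 2).const_mul A).mul hy)).add
    ((hx.const_mul (3 * B)).mul (hy.pow 2))).add ((hy.pow 3).const_mul A))
  have h3 := ((hasFDerivAt_id p).neg).add (h1.prodMk h2)
  refine (h3.congr_fderiv ?_)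
  ext <;> simp [cubicDeriv] <;> ring

/-- At `(z, e z)` the symmetric derivative has eigenvectors `(1, e)` and `(1, -e)`, with eigenvalues
`2` (from homogeneity: `3 - 1`) and `-4 e B z²`. The second is nonzero because `B ≠ 0`. -/
theorem cubicDeriv_startPt_injective (hp : 0 < A + 2 * B) (hm : 0 < A - 2 * B) (hB : B ≠ 0)
    (i : Fin 4) : Function.Injective (cubicDeriv A B (startPt A B i)) := by
  obtain ⟨z, e, h, he, hz⟩ := startPt_spec hp hm i
  rw [h, injective_iff_map_eq_zero]
  rintro ⟨x, y⟩ h0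
  simp only [cubicDeriv, ContinuousLinearMap.prod_apply, add_apply, smul_apply,
    ContinuousLinearMap.coe_fst', ContinuousLinearMap.coe_snd', smul_eq_mul, Prod.mk_eq_zero] at h0
  obtain ⟨h1, h2⟩ := h0
  have hz0 : z ≠ 0 := by rintro rfl; simp at hz
  have he0 : e ≠ 0 := by rintro rfl; simp at he
  have he1 : e = 1 ∨ e = -1 := mul_self_eq_one_iff.1 (by linarith)
  have k1 : 2 * (x + e * y) = 0 := by
    rcases he1 with rfl | rfl
    · linear_combination h1 + h2 - 3 * (x + y) * hz
    · linear_combination h1 - h2 - 3 * (x - y) * hz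
  have k2 : (-(4 * e * B * z ^ 2)) * (x - e * y) = 0 := by
    rcases he1 with rfl | rfl
    · linear_combination h1 - h2 - (x - y) * hz
    · linear_combination h1 + h2 - (x + y) * hz
  have k3 : x - e * y = 0 := (mul_eq_zero.1 k2).resolve_left
    (neg_ne_zero.2 (mul_ne_zero (mul_ne_zero (mul_ne_zero (by norm_num) he0) hB) (pow_ne_zero 2 hz0)))
  have hx : x = 0 := by linarith
  have hy : y = 0 := by
    have : e * y = 0 := by linarith
    exact (mul_eq_zero.1 this).resolve_left he0
  rw [hx, hy]; rfl

/-- The pairing equals `(z² + w²) ((A + 2B)(z + w)² + (A - 2B)(z - w)²) / 2`. The constant is not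
sharp. -/
theorem cubic_coercive (hp : 0 < A + 2 * B) (hm : 0 < A - 2 * B) :
    ∃ c > 0, ∀ p : ℝ × ℝ, c * ‖p‖ ^ 4 ≤ p.1 * (cubic A B p).1 + p.2 * (cubic A B p).2 := by
  refine ⟨min (A + 2 * B) (A - 2 * B) / 2, half_pos (lt_min hp hm), fun p => ?_⟩
  obtain ⟨z, w⟩ := p
  set m := min (A + 2 * B) (A - 2 * B)
  have m1 : m ≤ A + 2 * B := min_le_left _ _
  have m2 : m ≤ A - 2 * B := min_le_right _ _
  have m0 : 0 < m := lt_min hp hm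
  have e : z * (cubic A B (z, w)).1 + w * (cubic A B (z, w)).2 =
      (z ^ 2 + w ^ 2) * ((A + 2 * B) * (z + w) ^ 2 + (A - 2 * B) * (z - w) ^ 2) / 2 := by
    simp only [cubic]; ring
  have hn : ‖((z, w) : ℝ × ℝ)‖ ^ 2 ≤ z ^ 2 + w ^ 2 := by
    rw [Prod.norm_mk, Real.norm_eq_abs, Real.norm_eq_abs]
    rcases max_cases |z| |w| with h | h <;> rw [h.1, sq_abs] <;> nlinarith [sq_nonneg z, sq_nonneg w]
  have h1 : m * (2 * (z ^ 2 + w ^ 2)) ≤ (A + 2 * B) * (z + w) ^ 2 + (A - 2 * B) * (z - w) ^ 2 := by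
    nlinarith [mul_le_mul_of_nonneg_right m1 (sq_nonneg (z + w)),
      mul_le_mul_of_nonneg_right m2 (sq_nonneg (z - w))]
  have h2 : 0 ≤ z ^ 2 + w ^ 2 := by positivity
  have h3 : ‖((z, w) : ℝ × ℝ)‖ ^ 4 ≤ (z ^ 2 + w ^ 2) ^ 2 := by
    calc ‖((z, w) : ℝ × ℝ)‖ ^ 4 = (‖((z, w) : ℝ × ℝ)‖ ^ 2) ^ 2 := by ring
      _ ≤ _ := by gcongr
  change _ ≤ z * (cubic A B (z, w)).1 + w * (cubic A B (z, w)).2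
  rw [e]
  nlinarith [mul_le_mul_of_nonneg_left h1 h2, mul_le_mul_of_nonneg_left h3 m0.le]

end Planar

end PeriodicBif

/-! ### Rescaling and branches of the abstract bifurcation system -/

section Branches

variable {E F H R : Type*} [NormedAddCommGroup E] [NormedSpace ℝ E]
  [NormedAddCommGroup F] [NormedSpace ℝ F] [NormedAddCommGroup H] [NormedSpace ℝ H]
  [NormedAddCommGroup R] [NormedSpace ℝ R]
  {A : H ≃L[ℝ] R} {ι : H →L[ℝ] R} {π : F →L[ℝ] R} {q : F →L[ℝ] ℝ × ℝ}
  {ℓ : ℝ × ℝ →L[ℝ] E} {j : H →L[ℝ] E} {K : E → F} {C : ℝ}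

/-- The kernel component of a semilinear equation whose linear part is `A - μ ι`. -/
def kernelEq (q : F →L[ℝ] ℝ × ℝ) (ℓ : ℝ × ℝ →L[ℝ] E) (j : H →L[ℝ] E) (K : E → F)
    (μ : ℝ) (x : ℝ × ℝ) (y : H) : ℝ × ℝ :=
  -(μ • x) + q (K (ℓ x + j y))

/-- On the right `s` enters, apart from the common factor, only through `s² = μ`. The rescaled
system thus makes sense and is smooth for `μ` on both sides of `0`, although `√μ` is not. -/
theorem rangeEq_scaling (hK : IsCubicMap K C) (s : ℝ) (p : ℝ × ℝ) (η : H) :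
    rangeEq A ι π ℓ j K (s ^ 2) (s • p) (s ^ 3 • η) =
      s ^ 3 • rangeEq A ι π ℓ (s ^ 2 • j) K (s ^ 2) p η := by
  have e : ℓ (s • p) + j (s ^ 3 • η) = s • (ℓ p + (s ^ 2 • j) η) := by
    rw [map_smul, map_smul, smul_apply, smul_add, smul_smul]; congr 2; ring
  rw [rangeEq, rangeEq, e, hK.map_smul]
  simp only [_root_.map_smul]
  module

theorem kernelEq_scaling (hK : IsCubicMap K C) (s : ℝ) (p : ℝ × ℝ) (η : H) :
    kernelEq q ℓ j K (s ^ 2) (s • p) (s ^ 3 • η) =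
      s ^ 3 • kernelEq q ℓ (s ^ 2 • j) K 1 p η := by
  have e : ℓ (s • p) + j (s ^ 3 • η) = s • (ℓ p + (s ^ 2 • j) η) := by
    rw [map_smul, map_smul, smul_apply, smul_add, smul_smul]; congr 2; ring
  rw [kernelEq, kernelEq, e, hK.map_smul]
  simp only [_root_.map_smul]
  module

/-- A nondegenerate zero of the limit system is the end point of a smooth branch of solutions of
the scaled system. -/
theorem exists_scaled_branch [CompleteSpace H] [CompleteSpace R] (hK : IsCubicMap K C)
    {p₀ : ℝ × ℝ} {J : (ℝ × ℝ) ≃L[ℝ] ℝ × ℝ}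
    (hJ : HasFDerivAt (fun p => -p + q (K (ℓ p))) (J : ℝ × ℝ →L[ℝ] ℝ × ℝ) p₀)
    (h0 : -p₀ + q (K (ℓ p₀)) = 0) :
    ∃ (P : ℝ → ℝ × ℝ) (Y : ℝ → H) (η₀ : H), P 0 = p₀ ∧ A η₀ = -π (K (ℓ p₀)) ∧
      (∀ᶠ μ in 𝓝 0, ContDiffAt ℝ 1 P μ) ∧ ContinuousAt Y 0 ∧
      (∀ᶠ μ in 𝓝 0, rangeEq A ι π ℓ (μ • j) K μ (P μ) (Y μ) = 0 ∧
        kernelEq q ℓ (μ • j) K 1 (P μ) (Y μ) = 0) ∧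
      ∀ᶠ v in 𝓝 ((0, p₀, η₀) : ℝ × (ℝ × ℝ) × H),
        rangeEq A ι π ℓ (v.1 • j) K v.1 v.2.1 v.2.2 = 0 →
        kernelEq q ℓ (v.1 • j) K 1 v.2.1 v.2.2 = 0 → v.2.1 = P v.1 := by
  set η₀ : H := A.symm (-π (K (ℓ p₀))) with hη
  have hAη : A η₀ = -π (K (ℓ p₀)) := A.apply_symm_apply _
  let f : ℝ × (ℝ × ℝ) × H → (ℝ × ℝ) × R := fun v =>
    (kernelEq q ℓ (v.1 • j) K 1 v.2.1 v.2.2, rangeEq A ι π ℓ (v.1 • j) K v.1 v.2.1 v.2.2)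
  have hf : ContDiff ℝ ω f := by
    have := hK.contDiff
    simp only [f, rangeEq, kernelEq, smul_apply]
    fun_prop
  set u : ℝ × (ℝ × ℝ) × H := (0, p₀, η₀)
  have f0 : f u = 0 := by
    simp only [f, u, rangeEq, kernelEq, one_smul, zero_smul, zero_apply, add_zero, h0, hAη,
      sub_zero, neg_add_cancel, Prod.mk_zero_zero]
  have hKd : HasFDerivAt K (fderiv ℝ K (ℓ p₀)) (ℓ p₀) :=
    (hK.contDiff.differentiable (by simp)).differentiableAt.hasFDerivAt
  set B : ℝ × ℝ →L[ℝ] R := π ∘L (fderiv ℝ K (ℓ p₀) ∘L ℓ)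
  have hB : HasFDerivAt (fun p => π (K (ℓ p))) B p₀ :=
    π.hasFDerivAt.comp p₀ (hKd.comp p₀ ℓ.hasFDerivAt)
  -- At `μ = 0` the kernel equation does not contain `η`, so the derivative in `(p, η)` is block
  -- triangular with invertible diagonal blocks `J` and `A`.
  let L : ((ℝ × ℝ) × H) ≃L[ℝ] (ℝ × ℝ) × R := ContinuousLinearEquiv.equivOfInverse
    (((J : ℝ × ℝ →L[ℝ] ℝ × ℝ) ∘L .fst ℝ _ _).prod
      ((A : H →L[ℝ] R) ∘L .snd ℝ _ _ + B ∘L .fst ℝ _ _))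
    (((J.symm : ℝ × ℝ →L[ℝ] ℝ × ℝ) ∘L .fst ℝ _ _).prod
      ((A.symm : R →L[ℝ] H) ∘L
        (.snd ℝ _ _ - B ∘L ((J.symm : ℝ × ℝ →L[ℝ] ℝ × ℝ) ∘L .fst ℝ _ _))))
    (fun v => by simp) (fun v => by simp)
  have hd : fderiv ℝ f u ∘L .inr ℝ ℝ ((ℝ × ℝ) × H) = (L : (ℝ × ℝ) × H →L[ℝ] (ℝ × ℝ) × R) := by
    have h1 : HasFDerivAt (fun y => f (0, y)) (fderiv ℝ f u ∘L .inr ℝ ℝ ((ℝ × ℝ) × H)) (p₀, η₀) :=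
      HasFDerivAt.comp (p₀, η₀) (g := f) (f := fun y => ((0 : ℝ), y))
        ((hf.differentiable (by simp)).differentiableAt.hasFDerivAt) (hasFDerivAt_prodMk_right _ _)
    have h2 : HasFDerivAt (fun y => f (0, y)) (L : (ℝ × ℝ) × H →L[ℝ] (ℝ × ℝ) × R) (p₀, η₀) := by
      have e1 := HasFDerivAt.comp (p₀, η₀) (f := fun y : (ℝ × ℝ) × H => y.1) hJ hasFDerivAt_fst
      have e2 := HasFDerivAt.comp (p₀, η₀) (f := fun y : (ℝ × ℝ) × H => y.1) hB hasFDerivAt_fst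
      have e3 := HasFDerivAt.comp (p₀, η₀) (f := fun y : (ℝ × ℝ) × H => y.2)
        (A : H →L[ℝ] R).hasFDerivAt hasFDerivAt_snd
      have e4 := e1.prodMk (e3.add e2)
      have e5 : (fun y => f (0, y)) = fun y : (ℝ × ℝ) × H =>
          (-y.1 + q (K (ℓ y.1)), A y.2 + π (K (ℓ y.1))) := by
        funext y; simp [f, rangeEq, kernelEq]
      rw [e5]
      exact e4
    exact h1.unique h2
  have hi : (fderiv ℝ f u ∘L .inr ℝ ℝ ((ℝ × ℝ) × H)).IsInvertible := by
    rw [hd]; exact ContinuousLinearMap.isInvertible_equiv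
  have hfa : ContDiffAt ℝ ω f u := hf.contDiffAt
  set g := hfa.implicitFunction (by simp) hi with hg
  have g0 : g 0 = (p₀, η₀) := hfa.implicitFunction_apply_self (by simp) hi
  have gc : ContDiffAt ℝ ω g 0 := hfa.contDiffAt_implicitFunction (by simp) hi
  refine ⟨fun μ => (g μ).1, fun μ => (g μ).2, η₀, congrArg Prod.fst g0, hAη, ?_, gc.continuousAt.snd, ?_, ?_⟩
  · filter_upwards [gc.eventually (by simp)] with v hv
    exact (hv.of_le (by simp)).fst
  · have := hfa.eventually_apply_implicitFunction (by simp) hi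
    rw [f0] at this
    filter_upwards [this] with μ hμ
    exact ⟨congrArg Prod.snd hμ, congrArg Prod.fst hμ⟩
  · filter_upwards [hfa.eventually_apply_eq_iff_implicitFunction (by simp) hi] with v hv h1 h2
    rw [f0] at hv
    exact (congrArg Prod.fst (hv.1 (Prod.ext h2 h1))).symm

/-- Bounded solutions of the scaled system with a small parameter are close to solutions of the
limit system. -/
theorem eventually_scaled_close (hK : IsCubicMap K C) (p₀ : ℝ × ℝ) (b : ℝ) {ε : ℝ} (hε : 0 < ε) :
    ∀ᶠ v in 𝓝 ((0, p₀) : ℝ × (ℝ × ℝ)), ∀ η : H, ‖η‖ ≤ b →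
      rangeEq A ι π ℓ (v.1 • j) K v.1 v.2 η = 0 →
      kernelEq q ℓ (v.1 • j) K 1 v.2 η = 0 →
      ‖η - A.symm (-π (K (ℓ p₀)))‖ < ε ∧ ‖-p₀ + q (K (ℓ p₀))‖ < ε := by
  -- `θ` is the Lipschitz bound for `K (ℓ p + μ j η) - K (ℓ p₀)` over all `‖η‖ ≤ b`; it vanishes at
  -- `(0, p₀)`.
  let θ : ℝ × (ℝ × ℝ) → ℝ := fun v =>
    C * (‖ℓ‖ * ‖v.2‖ + |v.1| * ‖j‖ * b + ‖ℓ‖ * ‖p₀‖) ^ 2 * (‖ℓ‖ * ‖v.2 - p₀‖ + |v.1| * ‖j‖ * b)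
  have hθ : Continuous θ := by fun_prop
  have t1 : Tendsto (fun v : ℝ × (ℝ × ℝ) => ‖(A.symm : R →L[ℝ] H)‖ * (|v.1| * (‖ι‖ * b) +
      ‖π‖ * θ v)) (𝓝 (0, p₀)) (𝓝 0) := by
    have : Continuous (fun v : ℝ × (ℝ × ℝ) => ‖(A.symm : R →L[ℝ] H)‖ * (|v.1| * (‖ι‖ * b) +
      ‖π‖ * θ v)) := by fun_prop
    simpa [θ] using this.tendsto (0, p₀)
  have t2 : Tendsto (fun v : ℝ × (ℝ × ℝ) => ‖v.2 - p₀‖ + ‖q‖ * θ v) (𝓝 (0, p₀)) (𝓝 0) := by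
    have : Continuous (fun v : ℝ × (ℝ × ℝ) => ‖v.2 - p₀‖ + ‖q‖ * θ v) := by fun_prop
    simpa [θ] using this.tendsto (0, p₀)
  filter_upwards [t1.eventually (gt_mem_nhds hε), t2.eventually (gt_mem_nhds hε)]
    with v h1 h2 η hη hr hk
  have hC := hK.nonneg
  have hb : 0 ≤ b := (norm_nonneg _).trans hη
  have n1 : ‖(v.1 • j) η‖ ≤ |v.1| * ‖j‖ * b := by
    rw [smul_apply, norm_smul, Real.norm_eq_abs, mul_assoc]
    gcongr
    exact j.le_opNorm_of_le hη
  have n2 : ‖K (ℓ v.2 + (v.1 • j) η) - K (ℓ p₀)‖ ≤ θ v := by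
    refine (hK.lip _ _).trans ?_
    have e : ℓ v.2 + (v.1 • j) η - ℓ p₀ = ℓ (v.2 - p₀) + (v.1 • j) η := by
      rw [map_sub]; abel
    rw [e]
    simp only [θ]
    gcongr
    · exact (norm_add_le _ _).trans (add_le_add (ℓ.le_opNorm _) n1)
    · exact ℓ.le_opNorm _
    · exact (norm_add_le _ _).trans (add_le_add (ℓ.le_opNorm _) n1)
  constructor
  · refine lt_of_le_of_lt ?_ h1
    have e : η - A.symm (-π (K (ℓ p₀))) =
        A.symm (v.1 • ι η - π (K (ℓ v.2 + (v.1 • j) η) - K (ℓ p₀))) := by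
      rw [← A.symm_apply_apply η, ← map_sub]
      congr 1
      rw [A.symm_apply_apply, map_sub]
      rw [rangeEq] at hr
      have := hr
      rw [← sub_eq_zero, ← this]; abel
    rw [e]
    refine (A.symm : R →L[ℝ] H).le_opNorm_of_le ((norm_sub_le _ _).trans (add_le_add ?_ ?_))
    · rw [norm_smul, Real.norm_eq_abs]
      gcongr
      exact ι.le_opNorm_of_le hη
    · exact π.le_opNorm_of_le n2
  · refine lt_of_le_of_lt ?_ h2
    have e : -p₀ + q (K (ℓ p₀)) =
        (v.2 - p₀) - q (K (ℓ v.2 + (v.1 • j) η) - K (ℓ p₀)) := by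
      rw [kernelEq, one_smul] at hk
      rw [map_sub, ← sub_eq_zero, ← hk]; abel
    rw [e]
    exact (norm_sub_le _ _).trans (add_le_add le_rfl (q.le_opNorm_of_le n2))

open PeriodicBif in
-- By compactness of the ball it suffices to work near each `p₀`. If `p₀` is not a zero of the limit
-- field there are no solutions nearby, if `p₀ = 0` only the trivial one, and otherwise `p₀` is a
-- starting point. In that case `η` is forced close to `η₀`, so local uniqueness applies.
theorem eventually_scaled_mem_branch (hK : IsCubicMap K C) {a b : ℝ} (hp : 0 < a + 2 * b)
    (hm : 0 < a - 2 * b) (hb : b ≠ 0) (hc : ∀ p, q (K (ℓ p)) = cubic a b p)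
    {P : Fin 4 → ℝ → ℝ × ℝ} {η₀ : Fin 4 → H}
    (hη : ∀ i, A (η₀ i) = -π (K (ℓ (startPt a b i))))
    (hP : ∀ i, ∀ᶠ v in 𝓝 ((0, startPt a b i, η₀ i) : ℝ × (ℝ × ℝ) × H),
      rangeEq A ι π ℓ (v.1 • j) K v.1 v.2.1 v.2.2 = 0 →
      kernelEq q ℓ (v.1 • j) K 1 v.2.1 v.2.2 = 0 → v.2.1 = P i v.1) (r : ℝ) {D : ℝ} (hD : 0 ≤ D) :
    ∀ᶠ μ in 𝓝 0, ∀ p ∈ Metric.closedBall (0 : ℝ × ℝ) r, ∀ η : H, ‖η‖ ≤ D * ‖p‖ ^ 3 →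
      rangeEq A ι π ℓ (μ • j) K μ p η = 0 → kernelEq q ℓ (μ • j) K 1 p η = 0 → p ≠ 0 →
      ∃ i, p = P i μ := by
  have hC := hK.nonneg
  refine (isCompact_closedBall (0 : ℝ × ℝ) r).eventually_forall_of_forall_eventually
    fun p₀ _ => ?_
  have hball : ∀ᶠ v in 𝓝 ((0, p₀) : ℝ × (ℝ × ℝ)), ‖v.2‖ < ‖p₀‖ + 1 :=
    (continuous_snd.norm.tendsto ((0, p₀) : ℝ × (ℝ × ℝ))).eventually (gt_mem_nhds (by simp))
  have hbd : ∀ {p : ℝ × ℝ} {η : H}, ‖p‖ < ‖p₀‖ + 1 → ‖η‖ ≤ D * ‖p‖ ^ 3 →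
      ‖η‖ ≤ D * (‖p₀‖ + 1) ^ 3 := fun h1 h2 => h2.trans (by gcongr)
  by_cases hz : -p₀ + q (K (ℓ p₀)) = 0
  swap
  -- Taking `ε` to be the defect of `p₀` itself, closeness would say that the defect is smaller than
  -- itself.
  · filter_upwards [hball, eventually_scaled_close (A := A) (ι := ι) (π := π) (q := q) (j := j)
      hK p₀ (D * (‖p₀‖ + 1) ^ 3) (norm_pos_iff.2 hz)] with v h1 h2 η h3 h4 h5 _
    exact absurd (h2 η (hbd h1 h3) h4 h5).2 (lt_irrefl _)
  by_cases hp0 : p₀ = 0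
  · subst hp0
    -- Near the origin the kernel equation gives `‖p‖ ≤ m ‖p‖³`, which is impossible for `p ≠ 0`
    -- once `m ‖p‖² < 1`.
    set m := ‖q‖ * (C * (‖ℓ‖ + ‖j‖ * D) ^ 3)
    have t1 : ∀ᶠ v in 𝓝 ((0, 0) : ℝ × (ℝ × ℝ)), m * ‖v.2‖ ^ 2 < 1 := by
      have : Continuous fun v : ℝ × (ℝ × ℝ) => m * ‖v.2‖ ^ 2 := by fun_prop
      exact (this.tendsto (0, 0)).eventually (gt_mem_nhds (by simp))
    have t2 : ∀ᶠ v in 𝓝 ((0, 0) : ℝ × (ℝ × ℝ)), |v.1| < 1 := by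
      have : Continuous fun v : ℝ × (ℝ × ℝ) => |v.1| := by fun_prop
      exact (this.tendsto (0, 0)).eventually (gt_mem_nhds (by simp))
    filter_upwards [hball, t1, t2] with v h1 h2 h3 η h4 _ h6 h7
    exfalso
    rw [norm_zero, zero_add] at h1
    have e : v.2 = q (K (ℓ v.2 + (v.1 • j) η)) := by
      rw [kernelEq, one_smul, neg_add_eq_zero] at h6
      exact h6
    have n1 : ‖ℓ v.2 + (v.1 • j) η‖ ≤ (‖ℓ‖ + ‖j‖ * D) * ‖v.2‖ := by
      have k1 : ‖(v.1 • j) η‖ ≤ 1 * (‖j‖ * (D * ‖v.2‖)) := by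
        rw [smul_apply, norm_smul, Real.norm_eq_abs]
        gcongr
        refine j.le_opNorm_of_le (h4.trans ?_)
        gcongr
        exact pow_le_of_le_one (norm_nonneg _) h1.le (by norm_num)
      linarith [norm_add_le (ℓ v.2) ((v.1 • j) η), ℓ.le_opNorm v.2]
    have n2 : ‖v.2‖ ≤ m * ‖v.2‖ ^ 2 * ‖v.2‖ := by
      conv_lhs => rw [e]
      refine (q.le_opNorm_of_le ((hK.norm_le _).trans
        (mul_le_mul_of_nonneg_left (pow_le_pow_left₀ (norm_nonneg _) n1 3) hC))).trans ?_
      rw [mul_pow]; simp only [m]; apply le_of_eq; ring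
    have n3 : 0 < ‖v.2‖ := norm_pos_iff.2 h7
    nlinarith
  · rw [hc] at hz
    obtain ⟨i, rfl⟩ := eq_startPt_of_cubic_eq hp hm hb (neg_add_eq_zero.1 hz).symm hp0
    have hi : A.symm (-π (K (ℓ (startPt a b i)))) = η₀ i := by rw [← hη, A.symm_apply_apply]
    obtain ⟨ε, hε, hs⟩ := Metric.eventually_nhds_iff.1 (hP i)
    filter_upwards [hball, Metric.ball_mem_nhds _ hε, eventually_scaled_close (A := A) (ι := ι)
      (π := π) (q := q) (j := j) hK (startPt a b i) (D * (‖startPt a b i‖ + 1) ^ 3) hε]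
      with v h1 h2 h3 η h4 h5 h6 _
    have h7 := (h3 η (hbd h1 h4) h5 h6).1
    rw [hi, ← dist_eq_norm] at h7
    refine ⟨i, hs (y := (v.1, v.2, η)) ?_ h5 h6⟩
    rw [Metric.mem_ball, Prod.dist_eq, max_lt_iff] at h2
    rw [Prod.dist_eq, max_lt_iff, Prod.dist_eq, max_lt_iff]
    exact ⟨h2.1, h2.2, h7⟩

open PeriodicBif in
-- Pairing the kernel equation with `x` gives `c ‖x‖⁴ ≤ 2 μ ‖x‖² + 2 m ‖x‖⁶`, because replacing `ℓ x
-- + j y` by `ℓ x` costs only `O(‖x‖⁵)`. The last term is absorbed for small `x`.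
theorem exists_norm_sq_le_of_kernelEq (hK : IsCubicMap K C) {a b : ℝ} (hp : 0 < a + 2 * b)
    (hm : 0 < a - 2 * b) (hc : ∀ p, q (K (ℓ p)) = cubic a b p) {D : ℝ} (hD : 0 ≤ D) :
    ∃ δ > 0, ∃ r ≥ 0, ∀ (μ : ℝ) (x : ℝ × ℝ) (y : H), 0 ≤ μ → ‖x‖ < δ → ‖y‖ ≤ D * ‖x‖ ^ 3 →
      kernelEq q ℓ j K μ x y = 0 → ‖x‖ ^ 2 ≤ r * μ := by
  obtain ⟨c, hc0, hco⟩ := cubic_coercive hp hm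
  have hC := hK.nonneg
  set m := ‖q‖ * (C * (2 * ‖ℓ‖ + ‖j‖ * D) ^ 2 * (‖j‖ * D))
  have hm0 : 0 ≤ m := by positivity
  have t1 : ∀ᶠ t in 𝓝 (0 : ℝ), 4 * m * t ^ 2 < c := by
    have : Continuous fun t : ℝ => 4 * m * t ^ 2 := by fun_prop
    exact (this.tendsto 0).eventually (gt_mem_nhds (by simpa using hc0))
  obtain ⟨δ, hδ, hs⟩ := Metric.eventually_nhds_iff.1 t1
  refine ⟨min δ 1, lt_min hδ one_pos, 4 / c, by positivity, fun μ x y hμ hx hy h0 => ?_⟩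
  have hx1 : ‖x‖ ≤ 1 := hx.le.trans (min_le_right _ _)
  have hxm : 4 * m * ‖x‖ ^ 2 < c := hs (by simpa using hx.trans_le (min_le_left _ _))
  set e := q (K (ℓ x + j y) - K (ℓ x))
  have he : ‖e‖ ≤ m * ‖x‖ ^ 5 := by
    have n0 : ‖j y‖ ≤ ‖j‖ * D * ‖x‖ ^ 3 := by
      rw [mul_assoc]; exact j.le_opNorm_of_le hy
    have n1 : ‖j y‖ ≤ ‖j‖ * D * ‖x‖ := n0.trans (by
      gcongr; exact pow_le_of_le_one (norm_nonneg _) hx1 (by norm_num))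
    have n2 : ‖K (ℓ x + j y) - K (ℓ x)‖ ≤
        C * ((2 * ‖ℓ‖ + ‖j‖ * D) * ‖x‖) ^ 2 * (‖j‖ * D * ‖x‖ ^ 3) := by
      refine (hK.lip _ _).trans ?_
      rw [add_sub_cancel_left]
      gcongr
      linarith [norm_add_le (ℓ x) (j y), ℓ.le_opNorm x]
    refine (q.le_opNorm_of_le n2).trans (le_of_eq ?_)
    simp only [m]; ring
  have hk : cubic a b x = μ • x - e := by
    rw [kernelEq, neg_add_eq_zero] at h0
    rw [← hc]; simp only [e, map_sub]; rw [← h0]; abel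
  have h1 := hco x
  rw [hk] at h1
  simp only [Prod.fst_sub, Prod.snd_sub, Prod.smul_fst, Prod.smul_snd, smul_eq_mul] at h1
  have a1 : |x.1| ≤ ‖x‖ := norm_fst_le x
  have a2 : |x.2| ≤ ‖x‖ := norm_snd_le x
  have b1 : |e.1| ≤ m * ‖x‖ ^ 5 := (norm_fst_le e).trans he
  have b2 : |e.2| ≤ m * ‖x‖ ^ 5 := (norm_snd_le e).trans he
  have c1 : |x.1 * e.1| ≤ ‖x‖ * (m * ‖x‖ ^ 5) := by rw [abs_mul]; gcongr
  have c2 : |x.2 * e.2| ≤ ‖x‖ * (m * ‖x‖ ^ 5) := by rw [abs_mul]; gcongr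
  have d1 : x.1 ^ 2 ≤ ‖x‖ ^ 2 := sq_le_sq' (by linarith [neg_abs_le x.1]) ((le_abs_self _).trans a1)
  have d2 : x.2 ^ 2 ≤ ‖x‖ ^ 2 := sq_le_sq' (by linarith [neg_abs_le x.2]) ((le_abs_self _).trans a2)
  have f1 : c * ‖x‖ ^ 4 ≤ 2 * μ * ‖x‖ ^ 2 + 2 * (m * ‖x‖ ^ 6) := by
    have g1 := mul_le_mul_of_nonneg_left d1 hμ
    have g2 := mul_le_mul_of_nonneg_left d2 hμ
    have g3 := neg_abs_le (x.1 * e.1)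
    have g4 := neg_abs_le (x.2 * e.2)
    nlinarith
  rcases (norm_nonneg x).eq_or_lt with h | h
  · rw [← h, zero_pow two_ne_zero]; positivity
  · have f2 : 0 < ‖x‖ ^ 2 := by positivity
    have f3 : c * ‖x‖ ^ 2 ≤ 2 * μ + 2 * m * ‖x‖ ^ 2 * ‖x‖ ^ 2 := by
      refine le_of_mul_le_mul_right ?_ f2
      linarith [show c * ‖x‖ ^ 2 * ‖x‖ ^ 2 = c * ‖x‖ ^ 4 by ring,
        show (2 * μ + 2 * m * ‖x‖ ^ 2 * ‖x‖ ^ 2) * ‖x‖ ^ 2 =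
          2 * μ * ‖x‖ ^ 2 + 2 * (m * ‖x‖ ^ 6) by ring]
    rw [div_mul_eq_mul_div, le_div_iff₀ hc0]
    nlinarith [mul_le_mul_of_nonneg_right hxm.le f2.le]

open PeriodicBif in
/-- Small nontrivial solutions of the bifurcation system lie on one of the four branches. -/
theorem exists_mem_branch_of_small (hK : IsCubicMap K C) {a b : ℝ} (hp : 0 < a + 2 * b)
    (hm : 0 < a - 2 * b) (hb : b ≠ 0) (hc : ∀ p, q (K (ℓ p)) = cubic a b p)
    {P : Fin 4 → ℝ → ℝ × ℝ} {η₀ : Fin 4 → H}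
    (hη : ∀ i, A (η₀ i) = -π (K (ℓ (startPt a b i))))
    (hP : ∀ i, ∀ᶠ v in 𝓝 ((0, startPt a b i, η₀ i) : ℝ × (ℝ × ℝ) × H),
      rangeEq A ι π ℓ (v.1 • j) K v.1 v.2.1 v.2.2 = 0 →
      kernelEq q ℓ (v.1 • j) K 1 v.2.1 v.2.2 = 0 → v.2.1 = P i v.1) :
    ∃ δ > 0, ∀ (μ : ℝ) (x : ℝ × ℝ) (y : H), 0 < μ → μ < δ → ‖x‖ < δ → ‖y‖ < δ →
      rangeEq A ι π ℓ j K μ x y = 0 → kernelEq q ℓ j K μ x y = 0 → x ≠ 0 →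
      ∃ i, x = √μ • P i μ := by
  obtain ⟨δ₁, hδ₁, D, hD, h1⟩ :=
    exists_norm_le_pow_three (A := A) (ι := ι) (π := π) (ℓ := ℓ) (j := j) hK
  obtain ⟨δ₂, hδ₂, r, hr, h2⟩ := exists_norm_sq_le_of_kernelEq (q := q) (j := j) hK hp hm hc hD
  obtain ⟨δ₃, hδ₃, h3⟩ := Metric.eventually_nhds_iff.1
    (eventually_scaled_mem_branch hK hp hm hb hc hη hP (√r) hD)
  refine ⟨min δ₁ (min δ₂ δ₃), lt_min hδ₁ (lt_min hδ₂ hδ₃), fun μ x y hμ hμδ hx hy hR hk hx0 => ?_⟩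
  simp only [lt_min_iff] at hμδ hx hy
  have hy3 := h1 μ x y (by rw [abs_of_pos hμ]; exact hμδ.1) hx.1 hy.1 hR
  have hx2 := h2 μ x y hμ.le hx.2.1 hy3 hk
  -- The rescaled point `s⁻¹ • x` has norm at most `√r`, so it lies in the compact ball to which
  -- `h3` applies.
  set s := √μ
  have hs : 0 < s := Real.sqrt_pos.2 hμ
  have hs2 : s ^ 2 = μ := Real.sq_sqrt hμ.le
  have ex : s • s⁻¹ • x = x := smul_inv_smul₀ hs.ne' x
  have ey : s ^ 3 • (s ^ 3)⁻¹ • y = y := smul_inv_smul₀ (by positivity) y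
  have k1 := rangeEq_scaling (A := A) (ι := ι) (π := π) (ℓ := ℓ) (j := j) hK s (s⁻¹ • x)
    ((s ^ 3)⁻¹ • y)
  have k2 := kernelEq_scaling (q := q) (ℓ := ℓ) (j := j) hK s (s⁻¹ • x) ((s ^ 3)⁻¹ • y)
  rw [ex, ey, hs2, hR, eq_comm, smul_eq_zero_iff_right (by positivity)] at k1
  rw [ex, ey, hs2, hk, eq_comm, smul_eq_zero_iff_right (by positivity)] at k2
  have n1 : ‖s⁻¹ • x‖ = s⁻¹ * ‖x‖ := by rw [norm_smul, norm_inv, Real.norm_of_nonneg hs.le]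
  obtain ⟨i, hi⟩ := h3 (y := μ) (by simpa [abs_of_pos hμ] using hμδ.2.2) (s⁻¹ • x)
    (by
      rw [mem_closedBall_zero_iff, n1, inv_mul_le_iff₀ hs, ← Real.sqrt_mul hμ.le]
      exact Real.le_sqrt_of_sq_le (by linarith)) ((s ^ 3)⁻¹ • y)
    (by
      rw [n1, norm_smul, norm_inv, Real.norm_of_nonneg (by positivity), mul_pow, inv_pow]
      calc (s ^ 3)⁻¹ * ‖y‖ ≤ (s ^ 3)⁻¹ * (D * ‖x‖ ^ 3) := by gcongr
        _ = _ := by ring) k1 k2 (smul_ne_zero (inv_ne_zero hs.ne') hx0)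
  exact ⟨i, by rw [← hi, ex]⟩

open PeriodicBif in
/-- A bifurcation equation whose leading part is `-μ x + cubic a b x` has exactly four branches of
nontrivial solutions. -/
theorem exists_branches_of_rangeEq [CompleteSpace H] [CompleteSpace R] (hK : IsCubicMap K C)
    {a b : ℝ} (hp : 0 < a + 2 * b) (hm : 0 < a - 2 * b) (hb : b ≠ 0)
    (hc : ∀ p, q (K (ℓ p)) = cubic a b p) {G : Set (ℝ × (ℝ × ℝ))} (hG : G ∈ 𝓝 0)
    {Ψ : ℝ × (ℝ × ℝ) → H} (hΨ : Tendsto Ψ (𝓝 0) (𝓝 0))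
    (hr : ∀ v ∈ G, rangeEq A ι π ℓ j K v.1 v.2 (Ψ v) = 0) {U : Fin 4 → Set (ℝ × ℝ)}
    (hU : ∀ i, U i ∈ 𝓝 (startPt a b i)) (hU0 : ∀ i, (0 : ℝ × ℝ) ∉ U i) :
    ∃ (ε : Fin 4 → ℝ) (P : Fin 4 → ℝ → ℝ × ℝ),
      (∀ i, 0 < ε i ∧ P i 0 = startPt a b i ∧ ∀ μ, |μ| < ε i →
        ContDiffAt ℝ 1 (P i) μ ∧ P i μ ∈ U i ∧ (μ, √μ • P i μ) ∈ G ∧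
        (0 < μ → kernelEq q ℓ j K μ (√μ • P i μ) (Ψ (μ, √μ • P i μ)) = 0)) ∧
      ∀ᶠ v in 𝓝 (0 : ℝ × (ℝ × ℝ)), 0 < v.1 →
        v ∈ G ∧ ((kernelEq q ℓ j K v.1 v.2 (Ψ v) = 0 ∧ v.2 ≠ 0) ↔
          ∃ i, v.1 < ε i ∧ v.2 = √v.1 • P i v.1) := by
  have hJ : ∀ i, ∃ J : (ℝ × ℝ) ≃L[ℝ] ℝ × ℝ, (J : ℝ × ℝ →L[ℝ] ℝ × ℝ) =
      cubicDeriv a b (startPt a b i) := fun i =>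
    ⟨(LinearEquiv.ofInjectiveEndo _
      (cubicDeriv_startPt_injective hp hm hb i)).toContinuousLinearEquiv, rfl⟩
  choose J hJ using hJ
  have hbr := fun i => exists_scaled_branch (A := A) (ι := ι) (π := π) (q := q) (ℓ := ℓ) (j := j) hK
    (p₀ := startPt a b i) (J := J i)
    (by simp only [hc, hJ]; exact hasFDerivAt_cubic _ _ _)
    (by rw [hc, cubic_startPt hp hm, neg_add_cancel])
  choose P Y η₀ hP0 hη hPd hYc hz hloc using hbr
  obtain ⟨δ₁, hδ₁, hsmall⟩ := exists_mem_branch_of_small hK hp hm hb hc hη hloc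
  obtain ⟨δ₂, hδ₂, D, hD, huniq⟩ :=
    exists_norm_sub_le_rangeEq (A := A) (ι := ι) (π := π) (ℓ := ℓ) (j := j) hK
  set δ := min δ₁ δ₂
  have hδ : 0 < δ := lt_min hδ₁ hδ₂
  have hgood : ∀ᶠ v in 𝓝 (0 : ℝ × (ℝ × ℝ)), v ∈ G ∧ ‖Ψ v‖ < δ ∧ |v.1| < δ ∧ ‖v.2‖ < δ := by
    have c2 : Continuous fun v : ℝ × (ℝ × ℝ) => |v.1| := by fun_prop
    have c3 : Continuous fun v : ℝ × (ℝ × ℝ) => ‖v.2‖ := by fun_prop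
    have hΨn : ∀ᶠ v in 𝓝 (0 : ℝ × (ℝ × ℝ)), ‖Ψ v‖ < δ :=
      hΨ.norm.eventually (gt_mem_nhds (by simpa using hδ))
    filter_upwards [hG, hΨn, (c2.tendsto 0).eventually (gt_mem_nhds (by simpa using hδ)),
      (c3.tendsto 0).eventually (gt_mem_nhds (by simpa using hδ))] with v e1 e2 e3 e4
    exact ⟨e1, e2, e3, e4⟩
  -- These hold for `μ` of either sign: `√μ = 0` for `μ < 0`, and the square root is still
  -- continuous at `0`.
  have hev : ∀ i, ∀ᶠ μ in 𝓝 (0 : ℝ), ContDiffAt ℝ 1 (P i) μ ∧ P i μ ∈ U i ∧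
      (rangeEq A ι π ℓ (μ • j) K μ (P i μ) (Y i μ) = 0 ∧
        kernelEq q ℓ (μ • j) K 1 (P i μ) (Y i μ) = 0) ∧
      ((μ, √μ • P i μ) ∈ G ∧ ‖Ψ (μ, √μ • P i μ)‖ < δ ∧ |μ| < δ ∧ ‖√μ • P i μ‖ < δ) ∧
      ‖√μ ^ 3 • Y i μ‖ < δ := fun i => by
    have cP : ContinuousAt (P i) 0 := (hPd i).self_of_nhds.continuousAt
    have cs : ContinuousAt (fun μ : ℝ => √μ) 0 := Real.continuous_sqrt.continuousAt
    have hPU : ∀ᶠ μ in 𝓝 0, P i μ ∈ U i := cP.eventually_mem (by rw [hP0]; exact hU i)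
    have tg : Tendsto (fun μ => (μ, √μ • P i μ)) (𝓝 0) (𝓝 (0 : ℝ × (ℝ × ℝ))) := by
      have : ContinuousAt (fun μ => (μ, √μ • P i μ)) 0 := continuousAt_id.prodMk (cs.smul cP)
      simpa [← Prod.mk_zero_zero] using this.tendsto
    have tY : Tendsto (fun μ => ‖√μ ^ 3 • Y i μ‖) (𝓝 0) (𝓝 0) := by
      have c3 : ContinuousAt (fun μ : ℝ => √μ ^ 3) 0 := cs.pow 3
      have := (c3.smul (hYc i)).norm.tendsto
      simpa using this
    filter_upwards [hPd i, hPU, hz i, tg.eventually hgood, tY.eventually (gt_mem_nhds hδ)]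
      with μ e1 e2 e3 e4 e5
    exact ⟨e1, e2, e3, e4, e5⟩
  choose ε hε hεs using fun i => Metric.eventually_nhds_iff.1 (hev i)
  have hε' := fun i μ (hμ : |μ| < ε i) => hεs i (y := μ) (by simpa using hμ)
  have hred : ∀ i μ, |μ| < ε i → 0 < μ →
      kernelEq q ℓ j K μ (√μ • P i μ) (Ψ (μ, √μ • P i μ)) = 0 := by
    intro i μ hμ h0
    obtain ⟨-, -, ⟨z1, z2⟩, ⟨g1, g3, g4, g5⟩, g6⟩ := hε' i μ hμ
    have hs : √μ ^ 2 = μ := Real.sq_sqrt h0.le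
    have k1 := rangeEq_scaling (A := A) (ι := ι) (π := π) (ℓ := ℓ) (j := j) hK (√μ) (P i μ) (Y i μ)
    have k2 := kernelEq_scaling (q := q) (ℓ := ℓ) (j := j) hK (√μ) (P i μ) (Y i μ)
    rw [hs, z1, smul_zero] at k1
    rw [hs, z2, smul_zero] at k2
    -- Both `√μ³ • Y` and `Ψ` are small solutions of the range equation at the same `(μ, x)`, hence
    -- equal.
    have k4 := huniq μ (√μ • P i μ) _ _ (g4.trans_le (min_le_right _ _))
      (g5.trans_le (min_le_right _ _)) (g3.trans_le (min_le_right _ _))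
      (g6.trans_le (min_le_right _ _))
    rw [k1, hr _ g1, sub_self, norm_zero, mul_zero, norm_le_zero_iff, sub_eq_zero] at k4
    rw [k4]
    exact k2
  refine ⟨ε, P, fun i => ⟨hε i, hP0 i, fun μ hμ => ?_⟩, ?_⟩
  · obtain ⟨e1, e2, -, ⟨g1, -⟩, -⟩ := hε' i μ hμ
    exact ⟨e1, e2, g1, hred i μ hμ⟩
  · have hεe : ∀ᶠ v in 𝓝 (0 : ℝ × (ℝ × ℝ)), ∀ i, v.1 < ε i :=
      eventually_all.2 fun i => (continuous_fst.tendsto (0 : ℝ × (ℝ × ℝ))).eventually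
        (gt_mem_nhds (hε i))
    filter_upwards [hgood, hεe] with v hv hvε hμ
    obtain ⟨g1, g3, g4, g5⟩ := hv
    refine ⟨g1, ⟨fun ⟨r0, x0⟩ => ?_, ?_⟩⟩
    · rw [abs_of_pos hμ] at g4
      obtain ⟨i, hi⟩ := hsmall _ _ _ hμ (g4.trans_le (min_le_left _ _))
        (g5.trans_le (min_le_left _ _)) (g3.trans_le (min_le_left _ _)) (hr _ g1) r0 x0
      exact ⟨i, hvε i, hi⟩
    · rintro ⟨i, hi, hx⟩
      have hμε : |v.1| < ε i := by rwa [abs_of_pos hμ]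
      have r0 := hred i _ hμε hμ
      rw [← hx] at r0
      refine ⟨r0, ?_⟩
      rw [hx]
      refine smul_ne_zero (Real.sqrt_pos.2 hμ).ne' fun hP => hU0 i ?_
      rw [← hP]
      exact (hε' i _ hμε).2.1

end Branches

namespace PeriodicBif

/-! ### Absolutely continuous functions on a period -/

/-- `F` is absolutely continuous on `[0, T]` with derivative `f`. -/
structure IsPrimitive (T : ℝ) (F f : ℝ → ℝ) : Prop where
  integrable : IntervalIntegrable f volume 0 T
  eq : ∀ t ∈ Icc 0 T, F t = F 0 + ∫ s in (0 : ℝ)..t, f s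

namespace IsPrimitive

variable {T : ℝ} {F G f g : ℝ → ℝ}

theorem integrable_mono (h : IsPrimitive T F f) {t : ℝ} (ht : t ∈ Icc 0 T) :
    IntervalIntegrable f volume 0 t :=
  h.integrable.mono_set (by
    rw [uIcc_of_le ht.1, uIcc_of_le (ht.1.trans ht.2)]; exact Icc_subset_Icc_right ht.2)

/-- Stated for the primitive and not for `F`, which is controlled only on `[0, T]`. -/
theorem absolutelyContinuous (h : IsPrimitive T F f) (hT : 0 ≤ T) :
    AbsolutelyContinuousOnInterval (fun t => F 0 + ∫ s in (0 : ℝ)..t, f s) 0 T := by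
  have h1 : AbsolutelyContinuousOnInterval (fun _ : ℝ => F 0) 0 T :=
    (contDiff_const.contDiffOn).absolutelyContinuousOnInterval
  exact h1.add (h.integrable.absolutelyContinuousOnInterval_intervalIntegral (by simp [hT]))

theorem continuousOn (h : IsPrimitive T F f) (hT : 0 ≤ T) : ContinuousOn F (Icc 0 T) := by
  have := (h.absolutelyContinuous hT).continuousOn
  rw [uIcc_of_le hT] at this
  exact this.congr h.eq

theorem congr (h : IsPrimitive T F f) {f' : ℝ → ℝ} (hf : ∀ t, f t = f' t) : IsPrimitive T F f' := by
  rwa [← funext hf]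

theorem add (h : IsPrimitive T F f) (h' : IsPrimitive T G g) :
    IsPrimitive T (fun t => F t + G t) (fun t => f t + g t) where
  integrable := h.integrable.add h'.integrable
  eq t ht := by
    rw [intervalIntegral.integral_add (h.integrable_mono ht) (h'.integrable_mono ht), h.eq t ht,
      h'.eq t ht]
    ring

theorem const_mul (h : IsPrimitive T F f) (c : ℝ) :
    IsPrimitive T (fun t => c * F t) (fun t => c * f t) where
  integrable := h.integrable.const_mul c
  eq t ht := by rw [intervalIntegral.integral_const_mul, h.eq t ht]; ring

theorem of_hasDerivAt (hd : ∀ t, HasDerivAt F (f t) t) (hf : Continuous f) :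
    IsPrimitive T F f where
  integrable := hf.intervalIntegrable _ _
  eq t _ := by
    rw [intervalIntegral.integral_eq_sub_of_hasDerivAt (fun s _ => hd s)
      (hf.intervalIntegrable _ _)]
    ring

theorem integral (hf : IntervalIntegrable f volume 0 T) :
    IsPrimitive T (fun t => ∫ s in (0 : ℝ)..t, f s) f where
  integrable := hf
  eq t _ := by simp

/-- Integration by parts for absolutely continuous functions on each `[0, t]`, with the derivatives
identified almost everywhere by Lebesgue differentiation. -/
theorem mul (h : IsPrimitive T F f) (h' : IsPrimitive T G g) (hT : 0 ≤ T) :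
    IsPrimitive T (fun t => F t * G t) (fun t => f t * G t + F t * g t) where
  integrable := by
    have h1 := h.continuousOn hT
    have h2 := h'.continuousOn hT
    rw [← uIcc_of_le hT] at h1 h2
    exact (h.integrable.mul_continuousOn h2).add (h'.integrable.continuousOn_mul h1)
  eq t ht := by
    have sub : uIcc 0 t ⊆ uIcc 0 T := by
      rw [uIcc_of_le ht.1, uIcc_of_le hT]; exact Icc_subset_Icc_right ht.2
    have key := ((h.absolutelyContinuous hT).mono sub).integral_deriv_mul_eq_sub
      ((h'.absolutelyContinuous hT).mono sub)
    simp only [intervalIntegral.integral_same, add_zero, ← h.eq t ht, ← h'.eq t ht] at key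
    have e : ∫ s in (0 : ℝ)..t, f s * G s + F s * g s = F t * G t - F 0 * G 0 := by
      rw [← key]
      refine intervalIntegral.integral_congr_ae ?_
      filter_upwards [h.integrable.ae_hasDerivAt_integral, h'.integrable.ae_hasDerivAt_integral]
        with x h1 h2 hx
      have hx' : x ∈ uIcc 0 T := sub (uIoc_subset_uIcc hx)
      have h0 : (0 : ℝ) ∈ uIcc 0 T := by simp
      rw [((h1 hx' 0 h0).const_add (F 0)).deriv, ((h2 hx' 0 h0).const_add (G 0)).deriv,
        h.eq x (by rwa [uIcc_of_le hT] at hx'), h'.eq x (by rwa [uIcc_of_le hT] at hx')]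
    rw [e]; ring

theorem memLp (h : IsPrimitive T F f) (hT : 0 ≤ T) : MemLp F 2 (per T) := by
  have hc := h.continuousOn hT
  obtain ⟨C, hC⟩ := isCompact_Icc.exists_bound_of_continuousOn hc
  refine MemLp.of_bound ((hc.mono Ioc_subset_Icc_self).aestronglyMeasurable measurableSet_Ioc) C ?_
  filter_upwards [ae_restrict_mem measurableSet_Ioc] with t ht
  exact hC t (Ioc_subset_Icc_self ht)

end IsPrimitive

variable {T : ℝ}

theorem intervalIntegrable_period (v : L2 T) (hT : 0 < T) : IntervalIntegrable v volume 0 T :=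
  intervalIntegrable_coe v ⟨hT, le_rfl⟩

theorem hasPeriodicDeriv_iff (hT : 0 < T) {u v : L2 T} :
    HasPeriodicDeriv u v ↔ ∃ F : ℝ → ℝ, IsPrimitive T F v ∧ u =ᵐ[per T] F ∧ F T = F 0 := by
  have hi : ∫ s, v s ∂(per T) = ∫ s in (0 : ℝ)..T, v s :=
    (intervalIntegral.integral_of_le hT.le).symm
  constructor
  · rintro ⟨⟨c, hc⟩, h0⟩
    refine ⟨fun t => c + ∫ s in (0 : ℝ)..t, v s, ⟨intervalIntegrable_period v hT, by simp⟩, hc, ?_⟩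
    simp [← hi, h0]
  · rintro ⟨F, hF, hu, hp⟩
    refine ⟨⟨F 0, ?_⟩, ?_⟩
    · filter_upwards [hu, ae_restrict_mem measurableSet_Ioc] with t h1 ht
      rw [h1, hF.eq t (Ioc_subset_Icc_self ht)]
    · have := hF.eq T ⟨hT.le, le_rfl⟩
      rw [hi]; linarith

theorem inner_eq_integral (hT : 0 < T) (u v : L2 T) {f g : ℝ → ℝ} (hu : u =ᵐ[per T] f)
    (hv : v =ᵐ[per T] g) : inner ℝ u v = ∫ s in (0 : ℝ)..T, f s * g s := by
  rw [L2.inner_def, intervalIntegral.integral_of_le hT.le]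
  refine integral_congr_ae ?_
  filter_upwards [hu, hv] with t h1 h2
  rw [h1, h2]; simp [mul_comm]

/-- Integration by parts on a period. -/
theorem HasPeriodicDeriv.inner_eq_neg (hT : 0 < T) {u v u' v' : L2 T} (h : HasPeriodicDeriv u v)
    (h' : HasPeriodicDeriv u' v') : inner ℝ u v' = -inner ℝ v u' := by
  obtain ⟨F, hF, hu, hp⟩ := (hasPeriodicDeriv_iff hT).1 h
  obtain ⟨G, hG, hu', hp'⟩ := (hasPeriodicDeriv_iff hT).1 h'
  have h1 := (hF.mul hG hT.le).eq T ⟨hT.le, le_rfl⟩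
  rw [inner_eq_integral hT u v' hu (ae_eq_refl _), inner_eq_integral hT v u' (ae_eq_refl _) hu']
  have hc := hF.continuousOn hT.le
  have hc' := hG.continuousOn hT.le
  rw [← uIcc_of_le hT.le] at hc hc'
  rw [intervalIntegral.integral_add (hF.integrable.mul_continuousOn hc')
    (hG.integrable.continuousOn_mul hc), hp, hp'] at h1
  linarith

theorem exists_hasPeriodicDeriv (hT : 0 < T) (v : L2 T) (hv : ∫ s, v s ∂(per T) = 0) :
    ∃ u : L2 T, HasPeriodicDeriv u v := by
  have h := IsPrimitive.integral (intervalIntegrable_period v hT)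
  refine ⟨(h.memLp hT.le).toLp, (hasPeriodicDeriv_iff hT).2 ⟨_, h, MemLp.coeFn_toLp _, ?_⟩⟩
  rw [intervalIntegral.integral_of_le hT.le, intervalIntegral.integral_same]
  exact hv

/-- The constant function as an element of `L²`. -/
noncomputable def constL2 (T c : ℝ) : L2 T := (memLp_const c).toLp (fun _ => c)

theorem constL2_ae (T c : ℝ) : constL2 T c =ᵐ[per T] fun _ => c := MemLp.coeFn_toLp _

theorem hasPeriodicDeriv_const (hT : 0 < T) (c : ℝ) : HasPeriodicDeriv (constL2 T c) 0 := by
  refine (hasPeriodicDeriv_iff hT).2 ⟨fun _ => c, ⟨intervalIntegrable_period 0 hT, fun t ht => ?_⟩,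
    constL2_ae T c, rfl⟩
  rcases ht.1.eq_or_lt with rfl | h0
  · simp
  · rw [interval_congr (Lp.coeFn_zero ℝ 2 (per T)) ⟨h0, ht.2⟩]; simp

theorem inner_constL2 (c : ℝ) (v : L2 T) : inner ℝ v (constL2 T c) = c * ∫ s, v s ∂(per T) := by
  rw [L2.inner_def, ← integral_const_mul]
  refine integral_congr_ae ?_
  filter_upwards [constL2_ae T c] with t ht
  rw [ht]; simp

/-- The periodic derivative is determined by the integration by parts formula. -/
theorem hasPeriodicDeriv_of_inner (hT : 0 < T) {u v : L2 T}
    (h : ∀ f g : L2 T, HasPeriodicDeriv f g → inner ℝ u g = -inner ℝ v f) :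
    HasPeriodicDeriv u v := by
  have hv : ∫ s, v s ∂(per T) = 0 := by
    -- Testing with a constant, whose derivative is `0`, shows that `v` has mean zero and so has a
    -- periodic primitive `w`.
    have h1 := h _ _ (hasPeriodicDeriv_const hT 1)
    rw [inner_zero_right, inner_constL2] at h1
    linarith
  obtain ⟨w, hw⟩ := exists_hasPeriodicDeriv hT v hv
  -- Subtracting the mean of `u - w` makes `g` a periodic derivative, hence an admissible test
  -- function. Testing with it gives `‖g‖² = 0`, so `u - w` is constant.
  set c := (∫ s, (u - w : L2 T) s ∂(per T)) / T
  set g : L2 T := u - w - constL2 T c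
  have hg : ∫ s, g s ∂(per T) = 0 := by
    have e : ∫ s, g s ∂(per T) = (∫ s, (u - w : L2 T) s ∂(per T)) - ∫ _, c ∂(per T) := by
      rw [← integral_sub (integrable_coe _) (integrable_const _)]
      refine integral_congr_ae ?_
      filter_upwards [Lp.coeFn_sub (u - w) (constL2 T c), constL2_ae T c] with t h1 h2
      rw [h1, Pi.sub_apply, h2]
    rw [e]
    simp [c, hT.le]
    field_simp; ring
  obtain ⟨f, hf⟩ := exists_hasPeriodicDeriv hT g hg
  have h1 : inner ℝ (u - w) g = 0 := by
    rw [inner_sub_left, h f g hf, hw.inner_eq_neg hT hf, sub_self]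
  have h2 : inner ℝ (constL2 T c) g = 0 := by
    rw [real_inner_comm, inner_constL2, hg, mul_zero]
  have h3 : g = 0 := by
    rw [← inner_self_eq_zero (𝕜 := ℝ)]
    change inner ℝ (u - w - constL2 T c) g = 0
    rw [inner_sub_left, h1, h2, sub_self]
  have h4 : u = w + constL2 T c := by
    rw [← sub_eq_zero, ← h3]; simp only [g]; abel
  rw [h4]
  simpa using hw.add (hasPeriodicDeriv_const hT c)

/-- The integration by parts identities characterize membership, and each of them is a closed
condition on the triple. -/
theorem isClosed_H2 (hT : 0 < T) : IsClosed (H2 T : Set (PiLp 2 (fun _ : Fin 3 => L2 T))) := by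
  have e : (H2 T : Set (PiLp 2 (fun _ : Fin 3 => L2 T))) =
      ⋂ (f : L2 T) (g : L2 T) (_ : HasPeriodicDeriv f g),
        {p | inner ℝ (p 0) g = -inner ℝ (p 1) f ∧ inner ℝ (p 1) g = -inner ℝ (p 2) f} := by
    ext p
    simp only [mem_iInter]
    constructor
    · exact fun hp f g h => ⟨hp.1.inner_eq_neg hT h, hp.2.inner_eq_neg hT h⟩
    · exact fun hp => ⟨hasPeriodicDeriv_of_inner hT fun f g h => (hp f g h).1,
        hasPeriodicDeriv_of_inner hT fun f g h => (hp f g h).2⟩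
  rw [e]
  refine isClosed_iInter fun f => isClosed_iInter fun g => isClosed_iInter fun _ => ?_
  exact (isClosed_eq (by fun_prop) (by fun_prop)).and (isClosed_eq (by fun_prop) (by fun_prop))

theorem completeSpace_H2 (hT : 0 < T) : CompleteSpace (H2 T) :=
  (isClosed_H2 hT).completeSpace_coe

end PeriodicBif

namespace PeriodicBif

variable {T : ℝ}

/-! ### The operators of the periodic problem -/

/-- The embedding of `H²(𝕋)` in `L²`. -/
noncomputable def fnL (T : ℝ) : H2 T →L[ℝ] L2 T :=
  PiLp.proj 2 (fun _ : Fin 3 => L2 T) 0 ∘L (H2 T).subtypeL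

/-- The second derivative on `H²(𝕋)`. -/
noncomputable def deriv2L (T : ℝ) : H2 T →L[ℝ] L2 T :=
  PiLp.proj 2 (fun _ : Fin 3 => L2 T) 2 ∘L (H2 T).subtypeL

@[simp] theorem fnL_apply (u : H2 T) : fnL T u = fnH u := rfl

@[simp] theorem deriv2L_apply (u : H2 T) : deriv2L T u = deriv2H u := rfl

/-- The linearization as a continuous operator. -/
noncomputable def opLL (T lam : ℝ) : H2 T →L[ℝ] L2 T := deriv2L T + lam • fnL T

theorem opLL_apply (lam : ℝ) (u : H2 T) : opLL T lam u = deriv2H u + lam • fnH u := rfl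

theorem opLL_eq_zero {k : ℕ} (x : kerN T k) : opLL T (sigma T k) (x : H2 T) = 0 := x.2

theorem inner_deriv2H (hT : 0 < T) (u v : H2 T) :
    inner ℝ (deriv2H u) (fnH v) = inner ℝ (fnH u) (deriv2H v) := by
  have h1 := u.2.2.inner_eq_neg hT v.2.1
  have h2 := u.2.1.inner_eq_neg hT v.2.2
  rw [fnH, deriv2H, fnH, deriv2H, h2, h1, neg_neg]

theorem inner_opLL (hT : 0 < T) (lam : ℝ) (u v : H2 T) :
    inner ℝ (opLL T lam u) (fnH v) = inner ℝ (fnH u) (opLL T lam v) := by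
  simp only [opLL_apply, inner_add_left, inner_add_right, inner_smul_left, inner_smul_right,
    inner_deriv2H hT]
  rfl

theorem fnH_phiC (k : ℕ) : fnH (phiCH2 T k) = phiCL2 T k := rfl

theorem fnH_phiS (k : ℕ) : fnH (phiSH2 T k) = phiSL2 T k := rfl

theorem omega_pos (hT : 0 < T) {k : ℕ} (hk : 1 ≤ k) : 0 < 2 * Real.pi * k / T := by
  have : (0 : ℝ) < k := by exact_mod_cast hk
  positivity

/-- Since `φ_k'` is a nonzero multiple of `ϕ_k`, this is `(φ_k, φ_k') = 0` for a periodic function.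
-/
theorem inner_phiC_phiS (hT : 0 < T) {k : ℕ} (hk : 1 ≤ k) :
    inner ℝ (phiCL2 T k) (phiSL2 T k) = 0 := by
  have h := (phiCH2 T k).2.1.inner_eq_neg hT (phiCH2 T k).2.1
  change inner ℝ (phiCL2 T k) ((-(2 * Real.pi * k / T)) • phiSL2 T k) =
    -inner ℝ ((-(2 * Real.pi * k / T)) • phiSL2 T k) (phiCL2 T k) at h
  rw [real_inner_comm, inner_smul_left, real_inner_comm] at h
  have := omega_pos hT hk
  simp only [conj_trivial] at h
  have h2 : (2 * Real.pi * k / T) * inner ℝ (phiCL2 T k) (phiSL2 T k) = 0 := by linarith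
  exact (mul_eq_zero.1 h2).resolve_left this.ne'

/-- Integration by parts makes the two norms equal, and `cos² + sin² = 1` makes their squares add up
to `2`. -/
theorem inner_phiC_self (hT : 0 < T) {k : ℕ} (hk : 1 ≤ k) :
    inner ℝ (phiCL2 T k) (phiCL2 T k) = 1 ∧ inner ℝ (phiSL2 T k) (phiSL2 T k) = 1 := by
  have h := (phiCH2 T k).2.1.inner_eq_neg hT (phiSH2 T k).2.1
  change inner ℝ (phiCL2 T k) ((2 * Real.pi * k / T) • phiCL2 T k) =
    -inner ℝ ((-(2 * Real.pi * k / T)) • phiSL2 T k) (phiSL2 T k) at h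
  rw [inner_smul_left, inner_smul_right] at h
  simp only [conj_trivial] at h
  have h1 : inner ℝ (phiCL2 T k) (phiCL2 T k) = inner ℝ (phiSL2 T k) (phiSL2 T k) :=
    mul_left_cancel₀ (omega_pos hT hk).ne' (by linarith)
  have h2 : inner ℝ (phiCL2 T k) (phiCL2 T k) + inner ℝ (phiSL2 T k) (phiSL2 T k) = 2 := by
    rw [inner_eq_integral hT _ _ (phiCL2_ae T k) (phiCL2_ae T k),
      inner_eq_integral hT _ _ (phiSL2_ae T k) (phiSL2_ae T k),
      ← intervalIntegral.integral_add]
    · have e : ∀ s, phiC T k s * phiC T k s + phiS T k s * phiS T k s = 2 / T := fun s => by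
        have a1 := Real.sq_sqrt (show 0 ≤ 2 / T by positivity)
        have a2 := Real.cos_sq_add_sin_sq (2 * Real.pi * k / T * s)
        simp only [phiC, phiS]
        linear_combination √(2 / T) ^ 2 * a2 + a1
      simp only [e, intervalIntegral.integral_const, sub_zero, smul_eq_mul]
      field_simp
    · exact ((continuous_phiC T k).mul (continuous_phiC T k)).intervalIntegrable _ _
    · exact ((continuous_phiS T k).mul (continuous_phiS T k)).intervalIntegrable _ _
  constructor <;> linarith

/-- The coordinates of the projection on the kernel. -/
noncomputable def coordQ (T : ℝ) (k : ℕ) : L2 T →L[ℝ] ℝ × ℝ :=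
  (innerSL ℝ (phiCL2 T k)).prod (innerSL ℝ (phiSL2 T k))

theorem coordQ_apply (k : ℕ) (v : L2 T) :
    coordQ T k v = (inner ℝ v (phiCL2 T k), inner ℝ v (phiSL2 T k)) := by
  simp [coordQ, real_inner_comm]

theorem coordQ_opLL (hT : 0 < T) (k : ℕ) (u : H2 T) : coordQ T k (opLL T (sigma T k) u) = 0 := by
  rw [coordQ_apply, ← fnH_phiC, ← fnH_phiS, inner_opLL hT, inner_opLL hT,
    opLL_eq_zero ⟨_, phiCH2_mem T k⟩, opLL_eq_zero ⟨_, phiSH2_mem T k⟩, inner_zero_right]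
  rfl

theorem coordQ_projQ (hT : 0 < T) {k : ℕ} (hk : 1 ≤ k) (v : L2 T) :
    coordQ T k (projQ T k v) = coordQ T k v := by
  obtain ⟨h1, h2⟩ := inner_phiC_self hT hk
  have h3 := inner_phiC_phiS hT hk
  rw [real_inner_self_eq_norm_sq] at h1 h2
  have h4 := (real_inner_comm (phiCL2 T k) (phiSL2 T k)).trans h3
  simp [coordQ_apply, projQ, inner_add_left, inner_smul_left, h1, h2, h3, h4]

/-- The projection `Q_k` as a continuous operator. -/
noncomputable def projQL (T : ℝ) (k : ℕ) : L2 T →L[ℝ] L2 T :=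
  (innerSL ℝ (phiCL2 T k)).smulRight (phiCL2 T k) + (innerSL ℝ (phiSL2 T k)).smulRight (phiSL2 T k)

theorem projQL_apply (k : ℕ) (v : L2 T) : projQL T k v = projQ T k v := by
  simp [projQL, projQ, real_inner_comm]

theorem projQ_eq_zero {k : ℕ} {v : L2 T} (h : coordQ T k v = 0) : projQ T k v = 0 := by
  rw [coordQ_apply, Prod.mk_eq_zero] at h
  rw [projQ, h.1, h.2, zero_smul, zero_smul, add_zero]

/-- The range of the linearization at `σ_k`. -/
noncomputable abbrev rangeR (T : ℝ) (k : ℕ) : Submodule ℝ (L2 T) := (coordQ T k).ker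

/-- The projection `Id - Q_k` onto the range. -/
noncomputable def projR (hT : 0 < T) {k : ℕ} (hk : 1 ≤ k) : L2 T →L[ℝ] rangeR T k :=
  (ContinuousLinearMap.id ℝ (L2 T) - projQL T k).codRestrict (rangeR T k) fun v => by
    rw [LinearMap.mem_ker]
    change coordQ T k (v - projQL T k v) = 0
    rw [projQL_apply, map_sub, coordQ_projQ hT hk, sub_self]

theorem coe_projR (hT : 0 < T) {k : ℕ} (hk : 1 ≤ k) (v : L2 T) :
    (projR hT hk v : L2 T) = v - projQ T k v := by
  change v - projQL T k v = _
  rw [projQL_apply]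

/-- Variation of constants. -/
theorem exists_opLL_eq (hT : 0 < T) {k : ℕ} (hk : 1 ≤ k) {f : L2 T} (hf : coordQ T k f = 0) :
    ∃ u : H2 T, opLL T (sigma T k) u = f := by
  set w := 2 * Real.pi * k / T with hw
  have w0 : 0 < w := omega_pos hT hk
  have hσ : sigma T k = w ^ 2 := rfl
  have c1 : Continuous fun t => Real.cos (w * t) := by fun_prop
  have c2 : Continuous fun t => Real.sin (w * t) := by fun_prop
  have fi := intervalIntegrable_period f hT
  have hC := IsPrimitive.integral (fi.continuousOn_mul c1.continuousOn)
  have hS := IsPrimitive.integral (fi.continuousOn_mul c2.continuousOn)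
  set C : ℝ → ℝ := fun t => ∫ s in (0 : ℝ)..t, Real.cos (w * s) * f s
  set S : ℝ → ℝ := fun t => ∫ s in (0 : ℝ)..t, Real.sin (w * s) * f s
  have hcos : IsPrimitive T (fun t => Real.cos (w * t)) (fun t => -w * Real.sin (w * t)) := by
    refine .of_hasDerivAt (fun t => ?_) (by fun_prop)
    refine (((hasDerivAt_id t).const_mul w).cos).congr_deriv ?_
    simp; ring
  have hsin : IsPrimitive T (fun t => Real.sin (w * t)) (fun t => w * Real.cos (w * t)) := by
    refine .of_hasDerivAt (fun t => ?_) (by fun_prop)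
    refine (((hasDerivAt_id t).const_mul w).sin).congr_deriv ?_
    simp; ring
  have hr : √(2 / T) ≠ 0 := (Real.sqrt_pos.2 (by positivity)).ne'
  rw [coordQ_apply, Prod.mk_eq_zero, inner_eq_integral hT _ _ (ae_eq_refl _) (phiCL2_ae T k),
    inner_eq_integral hT _ _ (ae_eq_refl _) (phiSL2_ae T k)] at hf
  have C0 : C 0 = 0 := intervalIntegral.integral_same
  have S0 : S 0 = 0 := intervalIntegral.integral_same
  -- The orthogonality of `f` to `φ_k` and `ϕ_k` is exactly what makes the solution below periodic.
  have CT : C T = 0 := by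
    have e : √(2 / T) * C T = 0 := by
      rw [← hf.1, ← intervalIntegral.integral_const_mul]
      congr 1; funext s; simp only [phiC]; ring
    exact (mul_eq_zero.1 e).resolve_left hr
  have ST : S T = 0 := by
    have e : √(2 / T) * S T = 0 := by
      rw [← hf.2, ← intervalIntegral.integral_const_mul]
      congr 1; funext s; simp only [phiS]; ring
    exact (mul_eq_zero.1 e).resolve_left hr
  -- `U` is the solution with zero initial data and `V` is its derivative; both also vanish at `T`.
  let U : ℝ → ℝ := fun t => w⁻¹ * (Real.sin (w * t) * C t + -1 * (Real.cos (w * t) * S t))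
  let V : ℝ → ℝ := fun t => Real.cos (w * t) * C t + Real.sin (w * t) * S t
  have hU : IsPrimitive T U V := by
    refine (((hsin.mul hC hT.le).add ((hcos.mul hS hT.le).const_mul (-1))).const_mul w⁻¹).congr
      fun t => ?_
    simp only [V]; field_simp; ring
  have hV : IsPrimitive T V (fun t => f t - w ^ 2 * U t) := by
    refine ((hcos.mul hC hT.le).add (hsin.mul hS hT.le)).congr fun t => ?_
    simp only [U]
    have := Real.cos_sq_add_sin_sq (w * t)
    field_simp
    linear_combination f t * this
  set u : L2 T := (hU.memLp hT.le).toLp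
  set v : L2 T := (hV.memLp hT.le).toLp
  have hu : u =ᵐ[per T] U := MemLp.coeFn_toLp _
  have hv : v =ᵐ[per T] V := MemLp.coeFn_toLp _
  have hz : (f - (w ^ 2) • u : L2 T) =ᵐ[per T] fun t => f t - w ^ 2 * U t := by
    filter_upwards [Lp.coeFn_sub f ((w ^ 2) • u), smul_ae (w ^ 2) hu] with t h1 h2
    rw [h1, Pi.sub_apply, h2]
  have congr_prim : ∀ {F g : ℝ → ℝ} {z : L2 T}, IsPrimitive T F g → z =ᵐ[per T] g →
      IsPrimitive T F z := fun {F g z} h hz => by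
    refine ⟨intervalIntegrable_period z hT, fun t ht => ?_⟩
    rcases ht.1.eq_or_lt with rfl | h0
    · simp
    · rw [interval_congr hz ⟨h0, ht.2⟩, h.eq t ht]
  have p1 : HasPeriodicDeriv u v := (hasPeriodicDeriv_iff hT).2
    ⟨U, congr_prim hU hv, hu, by simp [U, C0, S0, CT, ST]⟩
  have p2 : HasPeriodicDeriv v (f - (w ^ 2) • u) := (hasPeriodicDeriv_iff hT).2
    ⟨V, congr_prim hV hz, hv, by simp [V, C0, S0, CT, ST]⟩
  refine ⟨⟨WithLp.toLp 2 ![u, v, f - (w ^ 2) • u], p1, p2⟩, ?_⟩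
  change f - (w ^ 2) • u + sigma T k • u = f
  rw [hσ, sub_add_cancel]

/-- For `x` in the kernel, integration by parts and `x'' = -σ_k x` give `(x, y)_{H²} = (1 + σ_k +
σ_k²) (x, y)_{L²}`, so the two notions of orthogonality to the kernel agree. -/
theorem coordQ_fnH_of_mem_orthogonal (hT : 0 < T) {k : ℕ} (y : (kerN T k)ᗮ) :
    coordQ T k (fnH (y : H2 T)) = 0 := by
  have key : ∀ x ∈ kerN T k, inner ℝ (fnH (y : H2 T)) (fnH x) = 0 := by
    intro x hx
    have h0 : inner ℝ x (y : H2 T) = 0 := y.2 x hx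
    have hx2 : deriv2H x = -(sigma T k • fnH x) := by
      rw [eq_neg_iff_add_eq_zero]; exact hx
    have e : inner ℝ x (y : H2 T) = inner ℝ (fnH x) (fnH (y : H2 T)) +
        inner ℝ ((x : PiLp 2 (fun _ : Fin 3 => L2 T)) 1)
          (((y : H2 T) : PiLp 2 (fun _ : Fin 3 => L2 T)) 1) +
        inner ℝ (deriv2H x) (deriv2H (y : H2 T)) := by
      rw [Submodule.coe_inner, PiLp.inner_apply, Fin.sum_univ_three]; rfl
    have i1 := x.2.2.inner_eq_neg hT (y : H2 T).2.1
    change _ = -inner ℝ (deriv2H x) (fnH (y : H2 T)) at i1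
    have i2 : inner ℝ (deriv2H (y : H2 T)) (fnH x) = -(sigma T k * inner ℝ (fnH x) (fnH (y : H2 T))) := by
      rw [inner_deriv2H hT, hx2, inner_neg_right, inner_smul_right, real_inner_comm]
    rw [e, i1, hx2, inner_neg_left, inner_neg_left, inner_smul_left, inner_smul_left,
      real_inner_comm (deriv2H (y : H2 T)) (fnH x), i2] at h0
    simp only [conj_trivial] at h0
    have hσ : 0 ≤ sigma T k := sq_nonneg _
    have : (1 + sigma T k + sigma T k ^ 2) * inner ℝ (fnH x) (fnH (y : H2 T)) = 0 := by
      linear_combination h0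
    rw [real_inner_comm]
    exact (mul_eq_zero.1 this).resolve_left (by positivity)
  rw [coordQ_apply, ← fnH_phiC, ← fnH_phiS, key _ (phiCH2_mem T k), key _ (phiSH2_mem T k)]
  rfl

theorem coordQ_isoL (hT : 0 < T) {k : ℕ} (hk : 1 ≤ k) (p : ℝ × ℝ) :
    coordQ T k (fnH (isoL T k p : H2 T)) = p := by
  obtain ⟨h1, h2⟩ := inner_phiC_self hT hk
  have h3 := inner_phiC_phiS hT hk
  change coordQ T k (p.1 • phiCL2 T k + p.2 • phiSL2 T k) = p
  rw [real_inner_self_eq_norm_sq] at h1 h2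
  have h4 := (real_inner_comm (phiCL2 T k) (phiSL2 T k)).trans h3
  simp [coordQ_apply, inner_add_left, inner_smul_left, h1, h2, h3, h4]


end PeriodicBif

/-! ### Invertibility of the linearization off its kernel -/

namespace PeriodicBif

variable {T : ℝ}

theorem isClosed_kerN (k : ℕ) : IsClosed (kerN T k : Set (H2 T)) :=
  (opLL T (sigma T k)).isClosed_ker

theorem completeSpace_kerN (hT : 0 < T) (k : ℕ) : CompleteSpace (kerN T k) :=
  have := completeSpace_H2 hT
  (isClosed_kerN k).completeSpace_coe

/-- Functions in the kernel are orthogonal to the range. -/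
theorem projR_fnH_kerN (hT : 0 < T) {k : ℕ} (hk : 1 ≤ k) (x : kerN T k) :
    projR hT hk (fnH (x : H2 T)) = 0 := by
  set p := coordQ T k (fnH (x : H2 T)) with hp
  set z : kerN T k := x - isoL T k p with hz
  have hzq : coordQ T k (fnH (z : H2 T)) = 0 := by
    change coordQ T k (fnL T ((x : H2 T) - (isoL T k p : H2 T))) = 0
    rw [map_sub, map_sub, fnL_apply, fnL_apply, coordQ_isoL hT hk, sub_self]
  -- An element `z` of the kernel with zero coordinates is also in the range, so symmetry gives `(z,
  -- z) = (u, 𝔏 z) = 0`. Thus the kernel is spanned by `φ_k` and `ϕ_k`.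
  obtain ⟨u, hu⟩ := exists_opLL_eq hT hk hzq
  have h0 : fnH (z : H2 T) = 0 := by
    rw [← inner_self_eq_zero (𝕜 := ℝ)]
    nth_rewrite 1 [← hu]
    rw [inner_opLL hT, opLL_eq_zero, inner_zero_right]
  have hx : fnH (x : H2 T) = fnH (isoL T k p : H2 T) := by
    rw [← sub_eq_zero]; exact h0
  ext1
  rw [coe_projR, hx, ZeroMemClass.coe_zero, sub_eq_zero]
  have e : inner ℝ (fnH (isoL T k p : H2 T)) (phiCL2 T k) = p.1 ∧
      inner ℝ (fnH (isoL T k p : H2 T)) (phiSL2 T k) = p.2 := by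
    have := coordQ_isoL hT hk p
    rw [coordQ_apply] at this
    exact ⟨congrArg Prod.fst this, congrArg Prod.snd this⟩
  rw [projQ, e.1, e.2]
  rfl

set_option maxSynthPendingDepth 3 in
/-- The linearization at `σ_k` is an isomorphism from the complement of its kernel onto the
complement of the kernel in `L²`. -/
theorem exists_equiv_opLL (hT : 0 < T) {k : ℕ} (hk : 1 ≤ k) :
    ∃ A : (kerN T k)ᗮ ≃L[ℝ] rangeR T k, ∀ y, (A y : L2 T) = opLL T (sigma T k) (y : H2 T) := by
  have := completeSpace_H2 hT
  have := completeSpace_kerN hT k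
  have : CompleteSpace (rangeR T k) := (coordQ T k).isClosed_ker.completeSpace_coe
  let f : (kerN T k)ᗮ →L[ℝ] rangeR T k :=
    (opLL T (sigma T k) ∘L (kerN T k)ᗮ.subtypeL).codRestrict (rangeR T k)
      fun y => LinearMap.mem_ker.2 (coordQ_opLL hT k y)
  have hi : f.ker = ⊥ := by
    rw [LinearMap.ker_eq_bot']
    intro y hy
    have h1 : (y : H2 T) ∈ kerN T k := congrArg Subtype.val hy
    have h2 : inner ℝ (y : H2 T) (y : H2 T) = 0 := y.2 _ h1
    exact Subtype.ext (inner_self_eq_zero.1 h2)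
  have hs : f.range = ⊤ := by
    rw [LinearMap.range_eq_top]
    rintro ⟨v, hv⟩
    obtain ⟨u, hu⟩ := exists_opLL_eq hT hk hv
    obtain ⟨y, hy, z, hz, rfl⟩ := (kerN T k).exists_add_mem_mem_orthogonal u
    refine ⟨⟨z, hz⟩, Subtype.ext ?_⟩
    change opLL T (sigma T k) z = v
    rw [← hu, map_add, opLL_eq_zero ⟨y, hy⟩, zero_add]
  exact ⟨.ofBijective f hi hs, fun _ => rfl⟩

/-! ### The cubic Nemytskii operator -/

/-- Multiplication `L^∞ × L² → L²`. -/
noncomputable def mulInf (T : ℝ) : LInf T →L[ℝ] L2 T →L[ℝ] L2 T :=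
  (ContinuousLinearMap.mul ℝ ℝ).holderL (per T) ⊤ 2 2

theorem mulInf_ae (w : LInf T) (v : L2 T) : mulInf T w v =ᵐ[per T] fun t => w t * v t :=
  (ContinuousLinearMap.mul ℝ ℝ).coeFn_holder w v

/-- Continuity comes from the closed graph theorem: multiplying by the constant `1` carries `L^∞`
convergence to `L²`, where the limit is already known. -/
theorem exists_supEmbedding (hT : 0 < T) :
    ∃ S : H2 T →L[ℝ] LInf T, ∀ u, S u =ᵐ[per T] fnH u := by
  have := completeSpace_H2 hT
  let S : H2 T →ₗ[ℝ] LInf T :=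
    { toFun u := (memLpH_top u).toLp
      map_add' u v := by
        ext1
        filter_upwards [(memLpH_top (u + v)).coeFn_toLp, (memLpH_top u).coeFn_toLp,
          (memLpH_top v).coeFn_toLp, Lp.coeFn_add (memLpH_top u).toLp (memLpH_top v).toLp,
          Lp.coeFn_add (fnH u) (fnH v)] with t h1 h2 h3 h4 h5
        rw [h1, h4, Pi.add_apply, h2, h3]
        exact h5
      map_smul' r u := by
        ext1
        filter_upwards [(memLpH_top (r • u)).coeFn_toLp, (memLpH_top u).coeFn_toLp,
          Lp.coeFn_smul r (memLpH_top u).toLp, Lp.coeFn_smul r (fnH u)] with t h1 h2 h3 h4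
        rw [h1, RingHom.id_apply, h3, Pi.smul_apply, h2]
        exact h4 }
  have hS : ∀ u, S u =ᵐ[per T] fnH u := fun u => (memLpH_top u).coeFn_toLp
  have hmul : ∀ w : LInf T, mulInf T w (constL2 T 1) =ᵐ[per T] w := fun w => by
    filter_upwards [mulInf_ae w (constL2 T 1), constL2_ae T 1] with t h1 h2
    rw [h1, h2, mul_one]
  refine ⟨.ofSeqClosedGraph (g := S) fun s x y hs hy => ?_, hS⟩
  have h1 : Tendsto (fun n => mulInf T (S (s n)) (constL2 T 1)) atTop
      (𝓝 (mulInf T y (constL2 T 1))) :=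
    (((mulInf T).flip (constL2 T 1)).continuous.tendsto y).comp hy
  have h2 : ∀ n, mulInf T (S (s n)) (constL2 T 1) = fnL T (s n) := fun n => by
    ext1
    exact (hmul _).trans (hS _)
  simp only [h2] at h1
  have h3 := tendsto_nhds_unique h1 (((fnL T).continuous.tendsto x).comp hs)
  ext1
  refine (hmul y).symm.trans ?_
  rw [h3]
  exact (hS x).symm

/-- The operator `u ↦ a u³` is a cubic map, and `𝔉` is its sum with the linearization. -/
theorem exists_cubicMap (hT : 0 < T) (a : LInf T) :
    ∃ (K : H2 T → L2 T) (C : ℝ), IsCubicMap K C ∧ (∀ u, K u =ᵐ[per T] fun t => a t * fnH u t ^ 3) ∧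
      ∀ (k : ℕ) (lam : ℝ) (u : H2 T), opF a lam u =
        opLL T (sigma T k) u - (sigma T k - lam) • fnH u + K u := by
  obtain ⟨S, hS⟩ := exists_supEmbedding hT
  have hK := isCubicMap_of_bilinear (mulInf T a) (mulInf T ∘L S) (fnL T)
  set K : H2 T → L2 T :=
    fun u => mulInf T a ((mulInf T ∘L S) u ((mulInf T ∘L S) u (fnL T u)))
  have hKae : ∀ u, K u =ᵐ[per T] fun t => a t * fnH u t ^ 3 := fun u => by
    filter_upwards [hS u, mulInf_ae a (mulInf T (S u) (mulInf T (S u) (fnL T u))),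
      mulInf_ae (S u) (mulInf T (S u) (fnL T u)), mulInf_ae (S u) (fnL T u)] with t h1 h2 h3 h4
    simp only [K, ContinuousLinearMap.comp_apply]
    rw [h2, h3, h4, h1, fnL_apply]; ring
  refine ⟨K, _, hK, hKae, fun k lam u => ?_⟩
  have e : (memLpH_cube a u).toLp (fun t => a t * fnH u t ^ 3) = K u := by
    ext1
    exact (MemLp.coeFn_toLp _).trans (hKae u).symm
  rw [opF, e, opLL_apply]
  module

/-! ### The moments of the weight -/

theorem integrable_weight_mul (a : LInf T) {h : ℝ → ℝ} (hh : Continuous h) :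
    Integrable (fun t => a t * h t) (per T) := by
  have h1 : MemLp (fun t => a t * h t) 2 (per T) := (memLp_of_continuous T hh).mul (Lp.memLp a)
  exact h1.integrable (by norm_num)

theorem integral_weight_sum (a : LInf T) {n : ℕ} (c : Fin n → ℝ) {h : Fin n → ℝ → ℝ}
    (hh : ∀ i, Continuous (h i)) :
    ∫ t, a t * ∑ i, c i * h i t ∂(per T) = ∑ i, c i * ∫ t, a t * h i t ∂(per T) := by
  have e : ∀ t, a t * ∑ i, c i * h i t = ∑ i, c i * (a t * h i t) := fun t => by
    rw [Finset.mul_sum]; exact Finset.sum_congr rfl fun i _ => by ring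
  simp only [e]
  rw [integral_finsetSum _ fun i _ => (integrable_weight_mul a (hh i)).const_mul _]
  simp only [integral_const_mul]

/-- Expand `(p₁ φ_k + p₂ ϕ_k)³` and test with `φ_k` and `ϕ_k`. The relations among the moments turn
`3 c_k` into `a_k`, `d_k` into `b_k` and `e_k` into `a_k`. -/
theorem coordQ_cube (a : LInf T) (k : ℕ) (h1 : coefA a k = 3 * coefC a k)
    (h2 : coefB a k = coefD a k) (h3 : coefA a k = coefE a k) {K : H2 T → L2 T}
    (hK : ∀ u, K u =ᵐ[per T] fun t => a t * fnH u t ^ 3) (p : ℝ × ℝ) :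
    coordQ T k (K (isoL T k p : H2 T)) = cubic (coefA a k) (coefB a k) p := by
  have hφ := continuous_phiC T k
  have hϕ := continuous_phiS T k
  have hu : fnH (isoL T k p : H2 T) =ᵐ[per T] fun t => p.1 * phiC T k t + p.2 * phiS T k t := by
    change (p.1 • phiCL2 T k + p.2 • phiSL2 T k : L2 T) =ᵐ[per T] _
    filter_upwards [Lp.coeFn_add (p.1 • phiCL2 T k) (p.2 • phiSL2 T k),
      smul_ae p.1 (phiCL2_ae T k), smul_ae p.2 (phiSL2_ae T k)] with t h1 h2 h3
    rw [h1, Pi.add_apply, h2, h3]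
  have hin : ∀ {v : L2 T} {ρ : ℝ → ℝ}, v =ᵐ[per T] ρ → inner ℝ (K (isoL T k p : H2 T)) v =
      ∫ t, a t * ∑ i, ![p.1 ^ 3, 3 * p.1 ^ 2 * p.2, 3 * p.1 * p.2 ^ 2, p.2 ^ 3] i *
        ![fun t => phiC T k t ^ 3 * ρ t, fun t => phiC T k t ^ 2 * phiS T k t * ρ t,
          fun t => phiC T k t * phiS T k t ^ 2 * ρ t, fun t => phiS T k t ^ 3 * ρ t] i t
            ∂(per T) := fun {v ρ} hv => by
    rw [L2.inner_def]
    refine integral_congr_ae ?_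
    filter_upwards [hK (isoL T k p : H2 T), hu, hv] with t e1 e2 e3
    rw [e1, e2, e3]
    simp [Fin.sum_univ_four]
    ring
  rw [coordQ_apply, hin (phiCL2_ae T k), hin (phiSL2_ae T k), integral_weight_sum, integral_weight_sum]
  rotate_left
  · intro i; fin_cases i <;> simp <;> fun_prop
  · intro i; fin_cases i <;> simp <;> fun_prop
  have mC : coefC a k = coefA a k / 3 := by linarith
  simp only [Fin.sum_univ_four, Matrix.cons_val, cubic]
  have eA : ∫ t, a t * (phiC T k t ^ 3 * phiC T k t) ∂(per T) = coefA a k := by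
    simp only [coefA, mul_assoc]
  have eB : ∫ t, a t * (phiC T k t ^ 2 * phiS T k t * phiC T k t) ∂(per T) = coefB a k := by
    simp only [coefB, mul_assoc]
  have eC : ∫ t, a t * (phiC T k t * phiS T k t ^ 2 * phiC T k t) ∂(per T) = coefA a k / 3 := by
    rw [← mC]; simp only [coefC, mul_assoc]
  have eD : ∫ t, a t * (phiS T k t ^ 3 * phiC T k t) ∂(per T) = coefB a k := by
    rw [h2]; simp only [coefD, mul_assoc]
  have eB' : ∫ t, a t * (phiC T k t ^ 3 * phiS T k t) ∂(per T) = coefB a k := by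
    rw [← eB]; congr 1; funext t; ring
  have eC' : ∫ t, a t * (phiC T k t ^ 2 * phiS T k t * phiS T k t) ∂(per T) = coefA a k / 3 := by
    rw [← eC]; congr 1; funext t; ring
  have eD' : ∫ t, a t * (phiC T k t * phiS T k t ^ 2 * phiS T k t) ∂(per T) = coefB a k := by
    rw [← eD]; congr 1; funext t; ring
  have eE : ∫ t, a t * (phiS T k t ^ 3 * phiS T k t) ∂(per T) = coefA a k := by
    rw [h3]; simp only [coefE, mul_assoc]
  rw [eA, eB, eC, eD, eB', eC', eD', eE]
  ext <;> simp <;> ring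

/-- Multiplying by `cos - e sin` shows that every zero is a zero of `cos (2 w t)`, and these are
countable. -/
theorem ae_phiC_add_phiS_ne_zero (hT : 0 < T) {k : ℕ} (hk : 1 ≤ k) {e : ℝ} (he : e ^ 2 = 1) :
    ∀ᵐ t ∂(per T), phiC T k t + e * phiS T k t ≠ 0 := by
  have w0 := omega_pos hT hk
  set w := 2 * Real.pi * k / T with hw
  have hr : √(2 / T) ≠ 0 := (Real.sqrt_pos.2 (by positivity)).ne'
  have hc : {t | phiC T k t + e * phiS T k t = 0}.Countable := by
    refine (countable_range fun n : ℤ => (2 * n + 1) * Real.pi / 2 / (2 * w)).mono fun t ht => ?_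
    have h1 : Real.cos (w * t) + e * Real.sin (w * t) = 0 := by
      have : √(2 / T) * (Real.cos (w * t) + e * Real.sin (w * t)) = 0 := by
        rw [← show phiC T k t + e * phiS T k t = 0 from ht]; simp only [phiC, phiS]; ring
      exact (mul_eq_zero.1 this).resolve_left hr
    have h2 : Real.cos (2 * (w * t)) = 0 := by
      rw [Real.cos_two_mul']
      linear_combination (Real.cos (w * t) - e * Real.sin (w * t)) * h1 + Real.sin (w * t) ^ 2 * he
    obtain ⟨n, hn⟩ := Real.cos_eq_zero_iff.1 h2
    exact ⟨n, by simp only [← hn]; field_simp⟩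
  exact ae_restrict_of_ae (measure_mono_null (fun t ht => by simpa using ht) (hc.measure_zero volume))

/-- Under the moment relations, `∫ a (φ_k + e ϕ_k)⁴ = 4 (a_k + 2 e b_k)`. The integral is positive
because the fourth power vanishes only on a null set and `a` is nonnegative and nonzero. -/
theorem coefA_add_pos (hT : 0 < T) {a : LInf T} (ha_nonneg : ∀ᵐ t ∂(per T), 0 ≤ a t) (ha_ne : a ≠ 0)
    {k : ℕ} (hk : 1 ≤ k) (h1 : coefA a k = 3 * coefC a k) (h2 : coefB a k = coefD a k)
    (h3 : coefA a k = coefE a k) {e : ℝ} (he : e ^ 2 = 1) :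
    0 < coefA a k + 2 * e * coefB a k := by
  have hφ := continuous_phiC T k
  have hϕ := continuous_phiS T k
  have key : ∫ t, a t * (phiC T k t + e * phiS T k t) ^ 4 ∂(per T) =
      4 * (coefA a k + 2 * e * coefB a k) := by
    have e0 : ∀ t, a t * (phiC T k t + e * phiS T k t) ^ 4 =
        a t * ∑ i, ![1, 4 * e, 6, 4 * e, 1] i * ![fun t => phiC T k t ^ 3 * phiC T k t,
          fun t => phiC T k t ^ 2 * phiS T k t * phiC T k t,
          fun t => phiC T k t * phiS T k t ^ 2 * phiC T k t,
          fun t => phiS T k t ^ 3 * phiC T k t, fun t => phiS T k t ^ 3 * phiS T k t] i t := by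
      intro t
      simp [Fin.sum_univ_five]
      have e3 : e ^ 3 = e := by linear_combination e * he
      have e4 : e ^ 4 = 1 := by linear_combination (e ^ 2 + 1) * he
      left
      ring_nf
      rw [he, e3, e4]
      ring
    simp only [e0]
    rw [integral_weight_sum _ _ (by intro i; fin_cases i <;> simp <;> fun_prop)]
    simp only [Fin.sum_univ_five, Matrix.cons_val, ← mul_assoc (a _)]
    change 1 * coefA a k + 4 * e * coefB a k + 6 * coefC a k + 4 * e * coefD a k + 1 * coefE a k = _
    rw [← h2, ← h3, h1]; ring
  have hnn : 0 ≤ᵐ[per T] fun t => a t * (phiC T k t + e * phiS T k t) ^ 4 := by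
    filter_upwards [ha_nonneg] with t ht
    have : 0 ≤ (phiC T k t + e * phiS T k t) ^ 4 := by positivity
    exact mul_nonneg ht this
  have hint : Integrable (fun t => a t * (phiC T k t + e * phiS T k t) ^ 4) (per T) :=
    integrable_weight_mul a (by fun_prop)
  have hpos : 0 < ∫ t, a t * (phiC T k t + e * phiS T k t) ^ 4 ∂(per T) := by
    refine (integral_nonneg_of_ae hnn).lt_of_ne fun h0 => ha_ne ?_
    have hz := (integral_eq_zero_iff_of_nonneg_ae hnn hint).1 h0.symm
    refine Lp.eq_zero_iff_ae_eq_zero.2 ?_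
    filter_upwards [hz, ae_phiC_add_phiS_ne_zero hT hk he] with t ht1 ht2
    exact (mul_eq_zero.1 ht1).resolve_right (pow_ne_zero 4 ht2)
  linarith

end PeriodicBif

namespace PeriodicBif

variable {T : ℝ}

/-! ### The reduction and the branches -/

section Reduction

set_option maxSynthPendingDepth 3

/-- The isomorphism `L` as a continuous operator. -/
noncomputable def isoLL (T : ℝ) (k : ℕ) : ℝ × ℝ →L[ℝ] kerN T k :=
  (ContinuousLinearMap.fst ℝ ℝ ℝ).smulRight ⟨phiCH2 T k, phiCH2_mem T k⟩ +
    (ContinuousLinearMap.snd ℝ ℝ ℝ).smulRight ⟨phiSH2 T k, phiSH2_mem T k⟩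

/-- The component in the range of the inclusion of the complement of the kernel in `L²`. -/
noncomputable def inclR (hT : 0 < T) {k : ℕ} (hk : 1 ≤ k) : (kerN T k)ᗮ →L[ℝ] rangeR T k :=
  projR hT hk ∘L fnL T ∘L (kerN T k)ᗮ.subtypeL

variable {k : ℕ} {a : LInf T} {A : (kerN T k)ᗮ ≃L[ℝ] rangeR T k} {K : H2 T → L2 T}

theorem auxG_eq (hT : 0 < T) (hk : 1 ≤ k)
    (hA : ∀ y, (A y : L2 T) = opLL T (sigma T k) (y : H2 T))
    (hop : ∀ (k : ℕ) (lam : ℝ) (u : H2 T), opF a lam u =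
      opLL T (sigma T k) u - (sigma T k - lam) • fnH u + K u)
    (lam : ℝ) (x : kerN T k) (y : (kerN T k)ᗮ) :
    auxG a k lam x y = rangeEq A (inclR hT hk) (projR hT hk) (kerN T k).subtypeL
      (kerN T k)ᗮ.subtypeL K (sigma T k - lam) x y := by
  have h1 : projR hT hk (opLL T (sigma T k) (y : H2 T)) = A y := by
    ext1
    rw [coe_projR, projQ_eq_zero (coordQ_opLL hT k _), sub_zero, hA]
  rw [auxG, ← coe_projR hT hk, hop k]
  have h2 : fnH ((x : H2 T) + (y : H2 T)) = fnH (x : H2 T) + fnH (y : H2 T) := rfl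
  rw [map_add (opLL T _), opLL_eq_zero, zero_add, h2, map_add, map_sub, h1, map_smul, map_add,
    projR_fnH_kerN, zero_add]
  rfl

theorem redH_eq (hT : 0 < T) (hk : 1 ≤ k)
    (hop : ∀ (k : ℕ) (lam : ℝ) (u : H2 T), opF a lam u =
      opLL T (sigma T k) u - (sigma T k - lam) • fnH u + K u)
    (ψ : ℝ × kerN T k → (kerN T k)ᗮ) (lam : ℝ) (p : ℝ × ℝ) :
    redH a k ψ lam p = kernelEq (coordQ T k) ((kerN T k).subtypeL ∘L isoLL T k)
      (kerN T k)ᗮ.subtypeL K (sigma T k - lam) p (ψ (lam, isoL T k p)) := by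
  rw [redH, ← coordQ_apply, coordQ_projQ hT hk, hop k]
  set y := ψ (lam, isoL T k p)
  have h2 : fnH ((isoL T k p : H2 T) + (y : H2 T)) =
    fnH (isoL T k p : H2 T) + fnH (y : H2 T) := rfl
  rw [map_add, map_sub, coordQ_opLL hT, map_smul, h2, map_add (coordQ T k) (fnH _), coordQ_isoL hT hk,
    coordQ_fnH_of_mem_orthogonal hT, add_zero, zero_sub]
  rfl

/-- Existence of the Lyapunov–Schmidt reduction. -/
theorem exists_isReduction (hT : 0 < T) (a : LInf T) (hk : 1 ≤ k) :
    ∃ (I : Set ℝ) (N : Set (kerN T k)) (ψ : ℝ × kerN T k → (kerN T k)ᗮ),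
      IsReduction a k I N ψ ∧
      ∃ O ∈ 𝓝 ((sigma T k, 0) : ℝ × H2 T), ∀ (lam : ℝ) (x : kerN T k) (y : (kerN T k)ᗮ),
        (lam, (x : H2 T) + (y : H2 T)) ∈ O → auxG a k lam x y = 0 →
          lam ∈ I ∧ x ∈ N ∧ y = ψ (lam, x) := by
  have := completeSpace_H2 hT
  have := completeSpace_kerN hT k
  have : CompleteSpace (rangeR T k) := (coordQ T k).isClosed_ker.completeSpace_coe
  obtain ⟨A, hA⟩ := exists_equiv_opLL hT hk
  obtain ⟨K, C, hK, -, hop⟩ := exists_cubicMap hT a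
  obtain ⟨ψ, h0, h1, h2, h3⟩ := exists_solution_rangeEq (A := A) (ι := inclR hT hk)
    (π := projR hT hk) (ℓ := (kerN T k).subtypeL) (j := (kerN T k)ᗮ.subtypeL) hK
  have h12 := h1.and h2
  rw [show (0 : ℝ × kerN T k) = (0, 0) from rfl, nhds_prod_eq] at h12
  obtain ⟨s, hs, N', hN', hsN⟩ := mem_prod_iff.1 h12
  obtain ⟨I, hIs, hIo, hI0⟩ := mem_nhds_iff.1 hs
  obtain ⟨N, hNN, hNo, hN0⟩ := mem_nhds_iff.1 hN'
  have good : ∀ μ ∈ I, ∀ x ∈ N, ContDiffAt ℝ ∞ ψ (μ, x) ∧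
      rangeEq A (inclR hT hk) (projR hT hk) (kerN T k).subtypeL (kerN T k)ᗮ.subtypeL K μ x
        (ψ (μ, x)) = 0 := fun μ hμ x hx => hsN ⟨hIs hμ, hNN hx⟩
  refine ⟨(fun lam => sigma T k - lam) ⁻¹' I, N, fun v => ψ (sigma T k - v.1, v.2),
    ⟨hIo.preimage (by fun_prop), by simpa using hI0, hNo, hN0, fun v hv => ?_, ?_, ?_⟩, ?_⟩
  · have hg : ContDiffAt ℝ ∞ (fun v : ℝ × kerN T k => (sigma T k - v.1, v.2)) v := by fun_prop
    exact ((good _ hv.1 _ hv.2).1.comp v hg).contDiffWithinAt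
  · change ψ (sigma T k - sigma T k, 0) = 0
    rw [sub_self]; exact h0
  · intro lam hlam x hx
    rw [auxG_eq hT hk hA hop, (good _ hlam x hx).2]
    rfl
  -- Orthogonal projections turn local uniqueness near the origin in `(μ, x, y)` into uniqueness for
  -- `(λ, u)` near `(σ_k, 0)`.
  · let Θ : ℝ × H2 T → (ℝ × kerN T k) × (kerN T k)ᗮ := fun v =>
      ((sigma T k - v.1, (kerN T k).orthogonalProjectionOnto v.2),
        (kerN T k)ᗮ.orthogonalProjectionOnto v.2)
    have hΘ : Continuous Θ := by fun_prop
    have hΘ0 : Θ (sigma T k, 0) = 0 := by simp [Θ]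
    have hI : ∀ᶠ v in 𝓝 (0 : (ℝ × kerN T k) × (kerN T k)ᗮ), v.1.1 ∈ I ∧ v.1.2 ∈ N := by
      have hc1 : Continuous fun v : (ℝ × kerN T k) × (kerN T k)ᗮ => v.1.1 := by fun_prop
      have hc2 : Continuous fun v : (ℝ × kerN T k) × (kerN T k)ᗮ => v.1.2 := by fun_prop
      exact ((hc1.tendsto 0).eventually (hIo.mem_nhds hI0)).and
        ((hc2.tendsto 0).eventually (hNo.mem_nhds hN0))
    have hO : ∀ᶠ v in 𝓝 ((sigma T k, 0) : ℝ × H2 T), ((Θ v).1.1 ∈ I ∧ (Θ v).1.2 ∈ N) ∧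
        (rangeEq A (inclR hT hk) (projR hT hk) (kerN T k).subtypeL (kerN T k)ᗮ.subtypeL K
          (Θ v).1.1 (Θ v).1.2 (Θ v).2 = 0 → (Θ v).2 = ψ (Θ v).1) := by
      have ht := hΘ.tendsto (sigma T k, 0)
      rw [hΘ0] at ht
      exact ht.eventually (hI.and h3)
    refine ⟨_, hO, fun lam x y hv hy => ?_⟩
    have e : Θ (lam, (x : H2 T) + (y : H2 T)) = ((sigma T k - lam, x), y) := by
      have e1 : (kerN T k).orthogonalProjectionOnto (y : H2 T) = 0 :=
        Submodule.orthogonalProjectionOnto_apply_of_mem_orthogonal y.2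
      have e2 : (kerN T k)ᗮ.orthogonalProjectionOnto (x : H2 T) = 0 :=
        Submodule.orthogonalProjectionOnto_apply_of_mem_orthogonal
          ((kerN T k).le_orthogonal_orthogonal x.2)
      simp [Θ, e1, e2]
    have hv' : ((Θ (lam, (x : H2 T) + (y : H2 T))).1.1 ∈ I ∧
        (Θ (lam, (x : H2 T) + (y : H2 T))).1.2 ∈ N) ∧ _ := hv
    rw [e] at hv'
    refine ⟨hv'.1.1, hv'.1.2, hv'.2 ?_⟩
    rw [auxG_eq hT hk hA hop] at hy
    exact Subtype.ext hy

end Reduction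

theorem fderiv_rescF_det_ne_zero {k : ℕ} {a : LInf T} (ψ : ℝ × kerN T k → (kerN T k)ᗮ)
    (hp : 0 < coefA a k + 2 * coefB a k) (hm : 0 < coefA a k - 2 * coefB a k)
    (hb : coefB a k ≠ 0) (i : Fin 4) :
    (fderiv ℝ (rescF a k ψ (sigma T k)) (startPt (coefA a k) (coefB a k) i)).det ≠ 0 := by
  have e : rescF a k ψ (sigma T k) = fun p => -p + cubic (coefA a k) (coefB a k) p := by
    funext p; simp [rescF]
  rw [e, (hasFDerivAt_cubic _ _ _).fderiv]
  refine IsUnit.ne_zero ((LinearMap.isUnit_iff_isUnit_det _).1 ?_)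
  exact (LinearMap.isUnit_iff_ker_eq_bot _).2
    (LinearMap.ker_eq_bot.2 (cubicDeriv_startPt_injective hp hm hb i))

/-- The four starting points and the origin have disjoint neighbourhoods. -/
theorem exists_disjoint_nhds_startPt {A B : ℝ} (hp : 0 < A + 2 * B) (hm : 0 < A - 2 * B) :
    ∃ U : Fin 4 → Set (ℝ × ℝ), (∀ i, U i ∈ 𝓝 (startPt A B i)) ∧ (∀ i, (0 : ℝ × ℝ) ∉ U i) ∧
      ∀ i j, i ≠ j → Disjoint (U i) (U j) := by
  obtain ⟨U, hU, hd⟩ := ((finite_range (startPt A B)).insert 0).t2_separation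
  have hmem : ∀ i, startPt A B i ∈ insert 0 (range (startPt A B)) := fun i =>
    mem_insert_of_mem _ (mem_range_self i)
  refine ⟨fun i => U (startPt A B i), fun i => (hU _).2.mem_nhds (hU _).1, fun i h0 => ?_,
    fun i j hij => hd (hmem i) (hmem j) ((startPt_injective hp hm).ne hij)⟩
  exact disjoint_left.1 (hd (hmem i) (mem_insert _ _) (startPt_ne_zero hp hm i)) h0 (hU 0).1

section Branches

set_option maxSynthPendingDepth 3

theorem exists_branches (hT : 0 < T) (a : LInf T) {k : ℕ} (hk : 1 ≤ k)
    (h1 : coefA a k = 3 * coefC a k) (h2 : coefB a k = coefD a k)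
    (h3 : coefA a k = coefE a k) (hb : coefB a k ≠ 0)
    (hp : 0 < coefA a k + 2 * coefB a k) (hm : 0 < coefA a k - 2 * coefB a k)
    {I : Set ℝ} {N : Set (kerN T k)} {ψ : ℝ × kerN T k → (kerN T k)ᗮ}
    (h : IsReduction a k I N ψ) {U : Fin 4 → Set (ℝ × ℝ)}
    (hU : ∀ i, U i ∈ 𝓝 (startPt (coefA a k) (coefB a k) i)) (hU0 : ∀ i, (0 : ℝ × ℝ) ∉ U i) :
    ∃ (ε : Fin 4 → ℝ) (P : Fin 4 → ℝ → ℝ × ℝ),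
      (∀ i, 0 < ε i ∧ P i 0 = startPt (coefA a k) (coefB a k) i ∧ ∀ μ, |μ| < ε i →
        ContDiffAt ℝ 1 (P i) μ ∧ P i μ ∈ U i ∧ sigma T k - μ ∈ I ∧
        isoL T k (√μ • P i μ) ∈ N ∧ (0 < μ → redH a k ψ (sigma T k - μ) (√μ • P i μ) = 0)) ∧
      ∀ᶠ v in 𝓝 ((sigma T k, 0) : ℝ × (ℝ × ℝ)), v.1 < sigma T k →
        v.1 ∈ I ∧ isoL T k v.2 ∈ N ∧ ((redH a k ψ v.1 v.2 = 0 ∧ v.2 ≠ 0) ↔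
          ∃ i, sigma T k - ε i < v.1 ∧ v.2 = √(sigma T k - v.1) • P i (sigma T k - v.1)) := by
  have := completeSpace_H2 hT
  have : CompleteSpace (rangeR T k) := (coordQ T k).isClosed_ker.completeSpace_coe
  obtain ⟨A, hA⟩ := exists_equiv_opLL hT hk
  obtain ⟨K, C, hK, hKae, hop⟩ := exists_cubicMap hT a
  have hc : ∀ p, coordQ T k (K (((kerN T k).subtypeL ∘L isoLL T k) p)) =
      cubic (coefA a k) (coefB a k) p := coordQ_cube a k h1 h2 h3 hKae
  let G : Set (ℝ × (ℝ × ℝ)) := {v | sigma T k - v.1 ∈ I ∧ isoL T k v.2 ∈ N}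
  let Ψ : ℝ × (ℝ × ℝ) → (kerN T k)ᗮ := fun v => ψ (sigma T k - v.1, isoL T k v.2)
  have hIN : I ×ˢ N ∈ 𝓝 ((sigma T k, 0) : ℝ × kerN T k) :=
    (h.isOpen_I.prod h.isOpen_N).mem_nhds ⟨h.sigma_mem, h.zero_mem⟩
  have ht : Tendsto (fun v : ℝ × (ℝ × ℝ) => (sigma T k - v.1, isoL T k v.2)) (𝓝 0)
      (𝓝 (sigma T k, 0)) := by
    have c1 : Continuous fun v : ℝ × (ℝ × ℝ) => (sigma T k - v.1, isoLL T k v.2) := by fun_prop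
    have t1 := c1.tendsto 0
    rwa [Prod.fst_zero, Prod.snd_zero, sub_zero, map_zero] at t1
  have hG : G ∈ 𝓝 0 := ht hIN
  have hΨ : Tendsto Ψ (𝓝 0) (𝓝 0) := by
    -- Of the regularity of `ψ`, only continuity at the base point enters here.
    have := (h.contDiffOn.continuousOn.continuousAt hIN).tendsto
    rw [h.base] at this
    exact this.comp ht
  have hr : ∀ v ∈ G, rangeEq A (inclR hT hk) (projR hT hk) ((kerN T k).subtypeL ∘L isoLL T k)
      (kerN T k)ᗮ.subtypeL K v.1 v.2 (Ψ v) = 0 := fun v hv => by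
    have e := (auxG_eq hT hk hA hop (sigma T k - v.1) (isoL T k v.2) (Ψ v)).symm.trans
      (h.solves _ hv.1 _ hv.2)
    rw [sub_sub_cancel] at e
    exact Subtype.ext e
  obtain ⟨ε, P, hP, hV⟩ := exists_branches_of_rangeEq hK hp hm hb hc hG hΨ hr hU hU0
  refine ⟨ε, P, fun i => ⟨(hP i).1, (hP i).2.1, fun μ hμ => ?_⟩, ?_⟩
  · obtain ⟨e1, e2, e3, e4⟩ := (hP i).2.2 μ hμ
    refine ⟨e1, e2, e3.1, e3.2, fun h0 => ?_⟩
    rw [redH_eq hT hk hop, sub_sub_cancel]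
    exact e4 h0
  · have c : Continuous fun v : ℝ × (ℝ × ℝ) => (sigma T k - v.1, v.2) := by fun_prop
    have t := c.tendsto (sigma T k, 0)
    rw [sub_self] at t
    filter_upwards [t.eventually hV] with v hv hlt
    obtain ⟨e1, e2⟩ := hv (sub_pos.2 hlt)
    have e3 : Ψ (sigma T k - v.1, v.2) = ψ (v.1, isoL T k v.2) := by simp only [Ψ, sub_sub_cancel]
    rw [e3, ← redH_eq hT hk hop] at e2
    simp only [G, mem_ofPred_eq, sub_sub_cancel] at e1
    refine ⟨e1.1, e1.2, e2.trans (exists_congr fun i => and_congr_left' ?_)⟩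
    exact sub_lt_comm

end Branches

end PeriodicBif

/-! ### The main theorem -/

open PeriodicBif in
theorem theorem3p16 (T : ℝ) (hT : 0 < T) (a : LInf T)
    (ha_nonneg : ∀ᵐ t ∂(per T), 0 ≤ a t) (ha_ne : a ≠ 0) (k : ℕ) (hk : 1 ≤ k)
    (h1 : coefA a k = 3 * coefC a k) (h2 : coefB a k = coefD a k)
    (h3 : coefA a k = coefE a k) (h4 : coefB a k ≠ 0) :
    -- the four starting points are well defined
    0 < coefA a k + 2 * coefB a k ∧ 0 < coefA a k - 2 * coefB a k ∧
    -- the reduction exists, and it captures all solutions of the auxiliary equation near `(σ_k, 0)`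
    (∃ (I : Set ℝ) (N : Set (kerN T k)) (ψ : ℝ × kerN T k → (kerN T k)ᗮ),
      IsReduction a k I N ψ ∧
      ∃ O ∈ 𝓝 ((sigma T k, 0) : ℝ × H2 T), ∀ (lam : ℝ) (x : kerN T k) (y : (kerN T k)ᗮ),
        (lam, (x : H2 T) + (y : H2 T)) ∈ O → auxG a k lam x y = 0 →
          lam ∈ I ∧ x ∈ N ∧ y = ψ (lam, x)) ∧
    -- the branches of the reduced system
    ∀ (I : Set ℝ) (N : Set (kerN T k)) (ψ : ℝ × kerN T k → (kerN T k)ᗮ),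
      IsReduction a k I N ψ →
      ∃ (ε : Fin 4 → ℝ) (U : Fin 4 → Set (ℝ × ℝ)) (g : Fin 4 → ℝ → ℝ × ℝ),
        (∀ i : Fin 4,
          0 < ε i ∧
          U i ∈ 𝓝 (startPt (coefA a k) (coefB a k) i) ∧
          (fderiv ℝ (rescF a k ψ (sigma T k)) (startPt (coefA a k) (coefB a k) i)).det ≠ 0 ∧
          MapsTo (g i) (Ioc (sigma T k - ε i) (sigma T k)) (U i) ∧
          ContDiffOn ℝ 1 (g i) (Ioc (sigma T k - ε i) (sigma T k)) ∧
          g i (sigma T k) = startPt (coefA a k) (coefB a k) i ∧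
          ∀ lam ∈ Ioc (sigma T k - ε i) (sigma T k),
            lam ∈ I ∧ isoL T k (√(sigma T k - lam) • g i lam) ∈ N ∧
            rescF a k ψ lam (g i lam) = 0) ∧
        -- the four branches are nontrivial and pairwise distinct
        (∀ i : Fin 4, (0 : ℝ × ℝ) ∉ U i) ∧
        (∀ i j : Fin 4, i ≠ j → Disjoint (U i) (U j)) ∧
        -- near `(σ_k, 0)` and for `lam < σ_k` there are no other nontrivial solutions
        ∃ V ∈ 𝓝 ((sigma T k, 0) : ℝ × (ℝ × ℝ)), ∀ (lam : ℝ) (x : ℝ × ℝ),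
          (lam, x) ∈ V → lam < sigma T k →
            lam ∈ I ∧ isoL T k x ∈ N ∧
            ((redH a k ψ lam x = 0 ∧ x ≠ 0) ↔
              ∃ i : Fin 4, sigma T k - ε i < lam ∧ x = √(sigma T k - lam) • g i lam) := by
  have hp : 0 < coefA a k + 2 * coefB a k := by
    simpa using coefA_add_pos hT ha_nonneg ha_ne hk h1 h2 h3 (e := 1) (by norm_num)
  have hm : 0 < coefA a k - 2 * coefB a k := by
    have := coefA_add_pos hT ha_nonneg ha_ne hk h1 h2 h3 (e := -1) (by norm_num)
    linarith
  refine ⟨hp, hm, exists_isReduction hT a hk, fun I N ψ h => ?_⟩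
  obtain ⟨U, hU, hU0, hUd⟩ := exists_disjoint_nhds_startPt hp hm
  obtain ⟨ε, P, hP, hV⟩ := exists_branches hT a hk h1 h2 h3 h4 hp hm h hU hU0
  have habs : ∀ {i : Fin 4} {lam : ℝ}, lam ∈ Ioc (sigma T k - ε i) (sigma T k) →
      |sigma T k - lam| < ε i := fun {i lam} hl => by
    rw [abs_of_nonneg (sub_nonneg.2 hl.2)]; linarith [hl.1]
  -- The branches are reparametrized by `μ = σ_k - λ`, and `V` is the set on which the eventual
  -- statement `hV` holds.
  refine ⟨ε, U, fun i lam => P i (sigma T k - lam), fun i => ?_, hU0, hUd, _, hV,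
    fun lam x hv hlam => hv hlam⟩
  obtain ⟨hε, hP0, hPi⟩ := hP i
  refine ⟨hε, hU i, fderiv_rescF_det_ne_zero ψ hp hm h4 i, fun lam hl => (hPi _ (habs hl)).2.1,
    fun lam hl => ?_, ?_, fun lam hl => ?_⟩
  · have hg : ContDiffAt ℝ 1 (fun lam => sigma T k - lam) lam := by fun_prop
    exact ((hPi _ (habs hl)).1.comp lam hg).contDiffWithinAt
  · simpa using hP0
  · obtain ⟨-, -, hI, hN, hr⟩ := hPi _ (habs hl)
    rw [sub_sub_cancel] at hI hr
    refine ⟨hI, hN, ?_⟩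
    rcases hl.2.lt_or_eq with hlt | rfl
    · rw [rescF, if_pos hlt, hr (sub_pos.2 hlt), smul_zero]
    -- At `λ = σ_k` the map is the limit field, which vanishes because the starting points are fixed
    -- by the cubic.
    · beta_reduce
      rw [rescF, if_neg (lt_irrefl _), sub_self, hP0, cubic_startPt hp hm, neg_add_cancel]
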